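/- Work over $\mathbb C$. Let $r\ge 0$ and $n\ge 2r+1$, and let $X=\mathbb G(r,n)\subset\mathbb P^N=\mathbb P(\bigwedge^{r+1}\mathbb C^{n+1})$ be the Grassmannian of $r$-planes in $\mathbb P^n$ in its Plücker embedding. For $m\ge 0$ let $T^m_p=T^m_pX\subset\mathbb P^N$ denote the $m$-osculating space of $X$ at $p$: the linear subspace cut out by the linear forms whose restriction to $X$ vanishes at $p$ to order at least $m+1$ (equivalently, at a smooth point $p$, the span of all partial derivatives of order $\le m$ at $p$ of a local parametrization of $X$). (1) $X$ has strong $2$-osculating regularity: for general points $p,q\in X$ and all integers $k_1,k_2\ge 0$ there are a smooth irreducible curve $C$, points $t_0,t_\infty\in C$ and a morphism $\gamma:C\to X$ with $\gamma(t_0)=p$ and $\gamma(t_\infty)=q$ such that the flat limit at $t_0$ of the family of linear spaces $\langle T^{k_1}_p,T^{k_2}_{\gamma(t)}\rangle$, $t\neq t_0$, is contained in $T^{k_1+k_2+1}_p$. (2) More precisely, for general points $p,q\in X$ there is a rational normal curve $\gamma:\mathbb P^1\to X\subset\mathbb P^N$ of degree $r+1$ with $\gamma(0)=p$ and $\gamma(\infty)=q$;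 and for every such curve and all integers $k_1,k_2\ge 0$ the flat limit of $\langle T^{k_1}_p,T^{k_2}_{\gamma(t)}\rangle$ as $t\to 0$ is contained in $T^{k_1+k_2+1}_p$. (3) $X$ has $\alpha$-osculating regularity with $\alpha=\left\lfloor\frac{n+1}{r+1}\right\rfloor$: for general points $p_1,\dots,p_\alpha\in X$ and every integer $k\ge 0$ there are a smooth irreducible curve $C$, points $t_0,t_\infty\in C$ and morphisms $\gamma_j:C\to X$, $j=2,\dots,\alpha$, with $\gamma_j(t_0)=p_1$ and $\gamma_j(t_\infty)=p_j$ such that the flat limit at $t_0$ of the family of linear spaces $\langle T^k_{p_1},T^k_{\gamma_2(t)},\dots,T^k_{\gamma_\alpha(t)}\rangle$, $t\neq t_0$, is contained in $T^{2k+1}_{p_1}$. -/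

import Mathlib

open scoped LinearAlgebra.Projectivization

noncomputable section

/-! ### Projective geometry over `ℂ`, with varieties given by their sets of closed points -/

/-- The cone (without its vertex) over a set of points of projective space: all homogeneous
coordinate vectors of points of `X`. For `X = {p}` these are the coordinate vectors of `p`. -/
def affineCone {ι : Type} (X : Set (ℙ ℂ (ι → ℂ))) : Set (ι → ℂ) :=
  {x | ∃ hx : x ≠ 0, Projectivization.mk ℂ x hx ∈ X}

/-- The homogeneous ideal of `X` in the homogeneous coordinate ring of projective space. -/
def homogeneousIdealOf {ι : Type} (X : Set (ℙ ℂ (ι → ℂ))) : Ideal (MvPolynomial ι ℂ) :=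
  MvPolynomial.vanishingIdeal ℂ (affineCone X)

/-- The linear form `∑ cᵢ xᵢ`. -/
def linearForm {ι : Type} [Fintype ι] (c : ι → ℂ) : MvPolynomial ι ℂ :=
  ∑ i, MvPolynomial.C (c i) * MvPolynomial.X i

/-- The restriction to `X` of the homogeneous form `F` lies in `𝔪ₚ ^ k ⊆ 𝒪_{X,p}`: in the
homogeneous coordinate ring of `X` localized at the homogeneous prime `P` of `p`, the form `F`
lies in the `k`-th power of the maximal ideal. -/
def VanishesToOrder {ι : Type} (X : Set (ℙ ℂ (ι → ℂ))) (p : ℙ ℂ (ι → ℂ)) (k : ℕ)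
    (F : MvPolynomial ι ℂ) : Prop :=
  ∃ G : MvPolynomial ι ℂ, G ∉ homogeneousIdealOf {p} ∧
    G * F ∈ homogeneousIdealOf {p} ^ k ⊔ homogeneousIdealOf X

/-- The `m`-osculating space `T_p^m X`, as a linear subspace of `ℂ^(N+1)`. It is the linear space
dual to the image of the jet map `j_{m,p} : ⟨x₀, …, x_N⟩ → 𝒪_X(1) ⊗ 𝒪_X / 𝔪ₚ^(m+1)`, i.e. it is
cut out by the linear forms in the kernel of `j_{m,p}`: those whose restriction to `X` vanishes at
`p` together with all its derivatives of order `≤ m`. At a smooth point this is the span of the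
partial derivatives of order `≤ m` of a local parametrization of `X` (in homogeneous
coordinates) at `p`. -/
def osculatingSpace {ι : Type} [Fintype ι] (X : Set (ℙ ℂ (ι → ℂ))) (m : ℕ)
    (p : ℙ ℂ (ι → ℂ)) : Submodule ℂ (ι → ℂ) :=
  ⨅ c ∈ {c : ι → ℂ | VanishesToOrder X p (m + 1) (linearForm c)},
    LinearMap.ker (Fintype.linearCombination ℂ c)

/-- The property `P` holds for a general `m`-tuple of points of `X`: it holds at all points of some
nonempty (basic) Zariski-open subset `{G ≠ 0}` of `X^m ⊆ (ℙ^N)^m`. -/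
def ForGeneralPoints {ι : Type} (X : Set (ℙ ℂ (ι → ℂ))) (m : ℕ)
    (P : (Fin m → ℙ ℂ (ι → ℂ)) → Prop) : Prop :=
  ∃ G : MvPolynomial (Fin m × ι) ℂ,
    let U : Set (Fin m → ℙ ℂ (ι → ℂ)) := {p | (∀ j, p j ∈ X) ∧
      ∃ x : Fin m → ι → ℂ, (∀ j, x j ∈ affineCone {p j}) ∧
        MvPolynomial.eval (fun a => x a.1 a.2) G ≠ 0}
    U.Nonempty ∧ ∀ p ∈ U, P p

/-! ### Curves, morphisms and flat limits of families of linear spaces -/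

/-- A smooth irreducible affine curve over `ℂ`, given by its coordinate ring. (Two given points of
a smooth irreducible curve always lie in a common affine open subset.) -/
structure SmoothAffineCurve where
  /-- the coordinate ring -/
  R : Type
  [commRing : CommRing R]
  [algebra : Algebra ℂ R]
  [isDomain : IsDomain R]
  [smooth : Algebra.Smooth ℂ R]
  dim_eq_one : ringKrullDim R = 1

attribute [instance] SmoothAffineCurve.commRing SmoothAffineCurve.algebra
  SmoothAffineCurve.isDomain SmoothAffineCurve.smooth

/-- The closed points of the affine variety with coordinate ring `R`. -/
abbrev ClosedPoints (R : Type) [CommRing R] [Algebra ℂ R] : Type := R →ₐ[ℂ] ℂ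

/-- A map from the affine variety with coordinate ring `R` to projective space is a morphism:
locally it is given by a tuple of regular functions. -/
def IsMorphism {ι : Type} {R : Type} [CommRing R] [Algebra ℂ R]
    (γ : ClosedPoints R → ℙ ℂ (ι → ℂ)) : Prop :=
  ∀ t : ClosedPoints R, ∃ f : ι → R, (fun i => t (f i)) ≠ 0 ∧
    ∀ s : ClosedPoints R, ∀ hs : (fun i => s (f i)) ≠ 0,
      γ s = Projectivization.mk ℂ (fun i => s (f i)) hs

/-- `W₀` is the flat limit at `t₀` of the family of linear spaces `W t`, `t ≠ t₀`: on a
neighbourhood `{h ≠ 0}` of `t₀` there is a subbundle (with a frame `b` of regular sections) of the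
trivial bundle `ℂ^(N+1)` with fibre `W t` for `t ≠ t₀` and with fibre `W₀` at `t₀`. -/
def IsFlatLimit {ι : Type} {R : Type} [CommRing R] [Algebra ℂ R] (t₀ : ClosedPoints R)
    (W : ClosedPoints R → Submodule ℂ (ι → ℂ)) (W₀ : Submodule ℂ (ι → ℂ)) : Prop :=
  ∃ (h : R) (d : ℕ) (b : Fin d → ι → R), t₀ h ≠ 0 ∧
    (∀ t : ClosedPoints R, t h ≠ 0 → LinearIndependent ℂ (fun j : Fin d => fun i => t (b j i))) ∧
    (∀ t : ClosedPoints R, t h ≠ 0 → t ≠ t₀ →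
      W t = Submodule.span ℂ (Set.range fun j : Fin d => fun i => t (b j i))) ∧
    W₀ = Submodule.span ℂ (Set.range fun j : Fin d => fun i => t₀ (b j i))

/-! ### Osculating regularity -/

/-- `X` has strong `2`-osculating regularity. -/
def HasStrongTwoOsculatingRegularity {ι : Type} [Fintype ι] (X : Set (ℙ ℂ (ι → ℂ))) : Prop :=
  ForGeneralPoints X 2 fun p => ∀ k₁ k₂ : ℕ,
    ∃ (C : SmoothAffineCurve) (t₀ tinf : ClosedPoints C.R) (γ : ClosedPoints C.R → ℙ ℂ (ι → ℂ)),
      IsMorphism γ ∧ (∀ t, γ t ∈ X) ∧ γ t₀ = p 0 ∧ γ tinf = p 1 ∧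
      ∃ T₀ : Submodule ℂ (ι → ℂ),
        IsFlatLimit t₀
          (fun t => osculatingSpace X k₁ (p 0) ⊔ osculatingSpace X k₂ (γ t)) T₀ ∧
        T₀ ≤ osculatingSpace X (k₁ + k₂ + 1) (p 0)

/-- `X` has `m`-osculating regularity (a notion for `m ≥ 1`). For `m = l + 1` the points are
`p 0, …, p l`, and `γ j` joins `p 0` to `p (j + 1)`. -/
def HasOsculatingRegularity {ι : Type} [Fintype ι] (X : Set (ℙ ℂ (ι → ℂ))) : ℕ → Prop
  | 0 => True
  | l + 1 => ForGeneralPoints X (l + 1) fun p => ∀ k : ℕ,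
      ∃ (C : SmoothAffineCurve) (t₀ tinf : ClosedPoints C.R)
        (γ : Fin l → ClosedPoints C.R → ℙ ℂ (ι → ℂ)),
        (∀ j, IsMorphism (γ j) ∧ (∀ t, γ j t ∈ X) ∧ γ j t₀ = p 0 ∧ γ j tinf = p j.succ) ∧
        ∃ T₀ : Submodule ℂ (ι → ℂ),
          IsFlatLimit t₀
            (fun t => osculatingSpace X k (p 0) ⊔ ⨆ j, osculatingSpace X k (γ j t)) T₀ ∧
          T₀ ≤ osculatingSpace X (2 * k + 1) (p 0)

/-! ### Rational normal curves -/

/-- `γ : ℙ¹ → ℙ^N` parametrizes a rational normal curve of degree `e`: it is given by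
`[s : t] ↦ [∑ s^(e-i) t^i aᵢ]` with `a₀, …, a_e` linearly independent. -/
def IsRationalNormalCurve {ι : Type} (e : ℕ) (γ : ℙ ℂ (Fin 2 → ℂ) → ℙ ℂ (ι → ℂ)) : Prop :=
  ∃ a : Fin (e + 1) → ι → ℂ, LinearIndependent ℂ a ∧
    ∀ (u : Fin 2 → ℂ) (hu : u ≠ 0),
      (∑ i : Fin (e + 1), (u 0 ^ (e - i : ℕ) * u 1 ^ (i : ℕ)) • a i) ∈
        affineCone {γ (Projectivization.mk ℂ u hu)}

/-- The point `[1 : t]` of `ℙ¹`. -/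
def projLinePoint (t : ℂ) : ℙ ℂ (Fin 2 → ℂ) :=
  Projectivization.mk ℂ ![1, t] (fun h => one_ne_zero (congrFun h 0))

/-- The point `∞ = [0 : 1]` of `ℙ¹`. -/
def projLineInfty : ℙ ℂ (Fin 2 → ℂ) :=
  Projectivization.mk ℂ ![0, 1] (fun h => one_ne_zero (congrFun h 1))

/-- The closed point `t = z` of the affine line, whose coordinate ring is `ℂ[t]`. -/
def affineLinePoint (z : ℂ) : ClosedPoints (Polynomial ℂ) := Polynomial.aeval z

/-- The coordinate of a closed point of the affine line. -/
def affineLineCoord (t : ClosedPoints (Polynomial ℂ)) : ℂ := t Polynomial.X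

/-! ### The Grassmannian -/

/-- The index set of the Plücker coordinates: subsets of `{0, …, n}` with `r + 1` elements. -/
abbrev PluckerIndex (r n : ℕ) : Type := {I : Finset (Fin (n + 1)) // I.card = r + 1}

/-- The Plücker coordinates of the rows `v₀, …, v_r` of the matrix `A`, i.e. the coordinates of
`v₀ ∧ ⋯ ∧ v_r` in the standard basis of `⋀^(r+1) ℂ^(n+1)`. -/
def pluckerCoords {r n : ℕ} (A : Matrix (Fin (r + 1)) (Fin (n + 1)) ℂ) :
    PluckerIndex r n → ℂ :=
  fun I => (A.submatrix id (I.1.orderEmbOfFin I.2)).det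

/-- The Grassmannian `𝔾(r, n)` of `r`-planes in `ℙ^n`, in its Plücker embedding. -/
def grassmannian (r n : ℕ) : Set (ℙ ℂ (PluckerIndex r n → ℂ)) :=
  {x | ∃ A : Matrix (Fin (r + 1)) (Fin (n + 1)) ℂ,
    LinearIndependent ℂ A.row ∧ pluckerCoords A ∈ affineCone {x}}

end

/-! A point of the Grassmannian is a matrix `A` up to row operations. Its `m`-osculating space is
the span `osc m A` of the wedges in which at most `m` rows of `A` are replaced
(`osculatingSpace_grassmannian`). If `A` spans a coordinate subspace with index set `u`, `osc m A`
contains every vector whose Plücker coordinates `J` with more than `m` elements outside `u` vanish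
(`mem_osc_coordMatrix`).

Let p be the coordinate point `u` and let the moving points be `δ • E + B j`, where `E` is the
coordinate matrix, `δ` is nonzero at t = 0, and `B j` vanishes at t = 0 and is supported in columns
`Q j` which are pairwise disjoint and avoid `u`. A vector of the flat limit is the value at 0 of
some w having a nonzero polynomial multiple in the ℂ[t]-span of the osculating generators, since
saturated submodules over a PID have frames that stay independent in every fibre
(`exists_isFlatLimit`). It remains to kill w_J(0) whenever J has at least k+k'+2 elements outside
`u`.

The tool is a second parameter s: right multiplication by `shearMatrix` scales the columns in `Q j`
by 1+s and subtracts `B j`, up to factors `δ`. The J-minor has s-degree at most k on generators at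
p, because the unreplaced rows do not see s. On generators at the moving point it is divisible by
s^(k+2), because the shear at s = 0 clears the columns of J outside `u` in each of the at least
r+1-k' unreplaced rows. So the coefficient of s^(k+1) annihilates both spaces, while at t = 0 it is
a nonzero multiple of the coordinate J (`eval_zero_mem_osc_coordMatrix`). With several moving points
the others count as p, which is where k' ≤ k enters.

General points are independent subspaces (`forGeneralPoints_grassmannian`), hence coordinate
subspaces in one basis, and the pencils (1-t)A₀ + tA_j have the required shape; a pencil through two
of them is a rational normal curve. An arbitrary polynomial curve also has this shape in the affine
chart around p, with a single `Q`, the complement of `u`; this gives the limit for every rational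
normal curve. -/

noncomputable section

/-! ### Plücker vectors, compound matrices and determinant estimates. -/

section Algebra

variable {r n : ℕ} {R : Type*} [CommRing R]

/-- The Plücker coordinates of the rows of a matrix, over a commutative ring. -/
def plucker (A : Matrix (Fin (r + 1)) (Fin (n + 1)) R) : PluckerIndex r n → R :=
  fun I => (A.submatrix id (I.1.orderEmbOfFin I.2)).det

lemma plucker_map {S : Type*} [CommRing S] (f : R →+* S)
    (A : Matrix (Fin (r + 1)) (Fin (n + 1)) R) (J : PluckerIndex r n) :
    plucker (A.map f) J = f (plucker A J) := by
  simp only [plucker, RingHom.map_det]; rfl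

lemma plucker_mul_left (h : Matrix (Fin (r + 1)) (Fin (r + 1)) R)
    (A : Matrix (Fin (r + 1)) (Fin (n + 1)) R) : plucker (h * A) = h.det • plucker A := by
  ext J
  simp only [plucker, Pi.smul_apply, smul_eq_mul, ← Matrix.det_mul]
  rfl

/-- The Plücker coordinates as an alternating map of the rows. -/
def pluckerAlternating (r n : ℕ) (R : Type*) [CommRing R] :
    (Fin (n + 1) → R) [⋀^Fin (r + 1)]→ₗ[R] (PluckerIndex r n → R) :=
  AlternatingMap.pi fun J =>
    (Matrix.detRowAlternating (R := R) (n := Fin (r + 1))).compLinearMap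
      (LinearMap.funLeft R R (J.1.orderEmbOfFin J.2))

lemma pluckerAlternating_apply (A : Matrix (Fin (r + 1)) (Fin (n + 1)) R) :
    pluckerAlternating r n R A = plucker A := rfl

/-- The **Cauchy–Binet formula**. -/
theorem det_mul_eq_sum_plucker (A : Matrix (Fin (r + 1)) (Fin (n + 1)) R)
    (N : Matrix (Fin (n + 1)) (Fin (r + 1)) R) :
    (A * N).det = ∑ J : PluckerIndex r n,
      plucker A J * (N.submatrix (J.1.orderEmbOfFin J.2) id).det := by
  let f : (Fin (n + 1) → R) [⋀^Fin (r + 1)]→ₗ[R] R :=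
    (Matrix.detRowAlternating (R := R) (n := Fin (r + 1))).compLinearMap N.vecMulLinear
  let L : (PluckerIndex r n → R) →ₗ[R] R :=
    Fintype.linearCombination R
      (fun J : PluckerIndex r n => (N.submatrix (J.1.orderEmbOfFin J.2) id).det)
  have hL : ∀ w, L w = ∑ J, w J * (N.submatrix (J.1.orderEmbOfFin J.2) id).det := by
    intro w; rfl
  suffices h : f = L.compAlternatingMap (pluckerAlternating r n R) by
    have h1 : f A = L (plucker A) := by rw [h]; rfl
    rw [hL] at h1
    exact h1
  -- Both sides are alternating in the rows of `A`, so distinct basis vectors suffice; once sorted,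
  -- their Plücker vector is a single unit vector.
  refine Module.Basis.ext_alternating (Pi.basisFun R (Fin (n + 1))) fun v hv => ?_
  let J : PluckerIndex r n := ⟨Finset.univ.image v, by
    rw [Finset.card_image_of_injective _ hv]; simp⟩
  let u := J.1.orderEmbOfFin J.2
  obtain ⟨σ, hσ⟩ : ∃ σ : Equiv.Perm (Fin (r + 1)), v = u ∘ σ := by
    have hr : ∀ i, ∃ j, u j = v i := by
      intro i
      have : v i ∈ Set.range u := by
        rw [Finset.range_orderEmbOfFin]; simp [J]
      exact this
    choose s hs using hr
    have hsi : Function.Injective s := fun a b hab => hv (by rw [← hs, ← hs, hab])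
    exact ⟨Equiv.ofBijective s (Finite.injective_iff_bijective.mp hsi), by ext i; simp [hs]⟩
  have key : ∀ F : (Fin (n + 1) → R) [⋀^Fin (r + 1)]→ₗ[R] R,
      F (fun i => Pi.basisFun R (Fin (n + 1)) (v i)) =
        Equiv.Perm.sign σ • F (fun i => Pi.basisFun R (Fin (n + 1)) (u i)) := by
    intro F
    rw [hσ]
    exact F.map_perm (fun i => Pi.basisFun R (Fin (n + 1)) (u i)) σ
  rw [key, key]
  congr 1
  rw [LinearMap.compAlternatingMap_apply, hL]
  have hA : (pluckerAlternating r n R fun i => Pi.basisFun R (Fin (n + 1)) (u i)) =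
      Pi.single J 1 := by
    ext K
    change Matrix.det (fun i j => Pi.basisFun R (Fin (n + 1)) (u i) (K.1.orderEmbOfFin K.2 j)) = _
    by_cases hK : K = J
    · subst hK
      rw [Pi.single_eq_same, ← Matrix.det_one (n := Fin (r + 1))]
      congr 1
      ext i j
      rw [Pi.basisFun_apply, Pi.single_apply, Matrix.one_apply]
      exact if_congr ⟨fun h => (u.injective h).symm, fun h => h ▸ rfl⟩ rfl rfl
    · rw [Pi.single_eq_of_ne hK]
      obtain ⟨c, hc, hc'⟩ : ∃ c ∈ K.1, c ∉ J.1 := by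
        by_contra! hcon
        exact hK (Subtype.ext (Finset.eq_of_subset_of_card_le hcon (by rw [J.2, K.2])))
      have : c ∈ Set.range (K.1.orderEmbOfFin K.2) := by
        rw [Finset.range_orderEmbOfFin]; exact hc
      obtain ⟨j, hj⟩ := this
      refine Matrix.det_eq_zero_of_column_eq_zero j fun i => ?_
      rw [Pi.basisFun_apply, hj, Pi.single_eq_of_ne]
      rintro rfl
      exact hc' (Finset.orderEmbOfFin_mem _ _ _)
  rw [hA, Finset.sum_eq_single J]
  · simp only [Pi.single_eq_same, one_mul]
    change Matrix.det _ = Matrix.det _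
    congr 1
    ext i j
    simp [u]
  · intro K _ hK; simp [hK]
  · simp

/-- The action of a matrix on `⋀^(r+1)`. -/
def compound (r : ℕ) (M : Matrix (Fin (n + 1)) (Fin (n + 1)) R) :
    (PluckerIndex r n → R) →ₗ[R] (PluckerIndex r n → R) :=
  LinearMap.pi fun K => Fintype.linearCombination R fun J : PluckerIndex r n =>
    (M.submatrix (J.1.orderEmbOfFin J.2) (K.1.orderEmbOfFin K.2)).det

lemma compound_apply (M : Matrix (Fin (n + 1)) (Fin (n + 1)) R) (w : PluckerIndex r n → R)
    (K : PluckerIndex r n) : compound r M w K = ∑ J : PluckerIndex r n,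
      w J * (M.submatrix (J.1.orderEmbOfFin J.2) (K.1.orderEmbOfFin K.2)).det := by
  simp [compound, Fintype.linearCombination_apply]

/-- Cauchy–Binet in each set of columns of `M`. This is how changes of basis of ℂ^(n+1) act on all
that follows. -/
lemma compound_plucker (M : Matrix (Fin (n + 1)) (Fin (n + 1)) R)
    (A : Matrix (Fin (r + 1)) (Fin (n + 1)) R) :
    compound r M (plucker A) = plucker (A * M) := by
  ext K
  rw [compound_apply]
  exact (det_mul_eq_sum_plucker A (M.submatrix id (K.1.orderEmbOfFin K.2))).symm

lemma compound_one (w : PluckerIndex r n → R) : compound r 1 w = w := by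
  ext K
  rw [compound_apply, Finset.sum_eq_single K]
  · rw [Matrix.submatrix_one _ (RelEmbedding.injective _)]; simp
  · intro J _ hJ
    obtain ⟨c, hc, hc'⟩ : ∃ c ∈ J.1, c ∉ K.1 := by
      by_contra! hcon
      exact hJ (Subtype.ext (Finset.eq_of_subset_of_card_le hcon (by rw [J.2, K.2])))
    have : c ∈ Set.range (J.1.orderEmbOfFin J.2) := by
      rw [Finset.range_orderEmbOfFin]; exact hc
    obtain ⟨j, hj⟩ := this
    rw [Matrix.det_eq_zero_of_row_eq_zero j, mul_zero]
    intro i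
    rw [Matrix.submatrix_apply, hj, Matrix.one_apply_ne]
    rintro rfl
    exact hc' (Finset.orderEmbOfFin_mem _ _ _)
  · simp

lemma compound_mul (M N : Matrix (Fin (n + 1)) (Fin (n + 1)) R) (w : PluckerIndex r n → R) :
    compound r N (compound r M w) = compound r (M * N) w := by
  ext K
  simp only [compound_apply, Finset.sum_mul]
  rw [Finset.sum_comm]
  refine Finset.sum_congr rfl fun J _ => ?_
  have := det_mul_eq_sum_plucker (M.submatrix (J.1.orderEmbOfFin J.2) id)
    (N.submatrix id (K.1.orderEmbOfFin K.2))
  rw [Matrix.submatrix_mul _ _ _ id _ Function.bijective_id, this, Finset.mul_sum]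
  refine Finset.sum_congr rfl fun L _ => ?_
  rw [mul_assoc]
  rfl

/-- The matrix with the rows of `B` in the positions of `S` and the rows of `A` elsewhere. -/
def rowMix {a : ℕ} {κ : Type*} {R : Type*} (S : Finset (Fin a)) (B A : Matrix (Fin a) κ R) :
    Matrix (Fin a) κ R :=
  Matrix.of fun i j => if i ∈ S then B i j else A i j

lemma rowMix_apply {a : ℕ} {κ : Type*} {R : Type*} (S : Finset (Fin a))
    (B A : Matrix (Fin a) κ R) (i : Fin a) (j : κ) :
    rowMix S B A i j = if i ∈ S then B i j else A i j := rfl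

/-- The matrix with rows `e_{u 0}, …, e_{u r}`. -/
def coordMatrix (R : Type*) [CommRing R] (u : Fin (r + 1) → Fin (n + 1)) :
    Matrix (Fin (r + 1)) (Fin (n + 1)) R :=
  Matrix.of fun i => Pi.single (u i) 1

lemma coordMatrix_apply (u : Fin (r + 1) → Fin (n + 1)) (i : Fin (r + 1)) (c : Fin (n + 1)) :
    coordMatrix R u i c = if c = u i then 1 else 0 := by
  simp [coordMatrix, Pi.single_apply]

lemma plucker_updateRow (A : Matrix (Fin (r + 1)) (Fin (n + 1)) R) (a : Fin (r + 1))
    (x : Fin (n + 1) → R) :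
    plucker (A.updateRow a x) = ∑ c, x c • plucker (A.updateRow a (Pi.single c 1)) := by
  have hx : x = ∑ c, x c • Pi.single c (1 : R) := by
    ext c; simp [Pi.single_apply]
  have h := (pluckerAlternating r n R).toMultilinearMap.map_update_sum Finset.univ a
    (fun c => x c • Pi.single c (1 : R)) A
  rw [← hx] at h
  refine h.trans (Finset.sum_congr rfl fun c _ => ?_)
  exact (pluckerAlternating r n R).toMultilinearMap.map_update_smul A a (x c) (Pi.single c 1)

/-! ### The span of the Plücker vectors sharing all but `m` rows with a given matrix -/

/-- The span of the vectors `v₀ ∧ ⋯ ∧ v_r` in which all but at most `m` of the `vᵢ` are the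
corresponding rows of `A` (and the others are standard basis vectors). -/
def osc (m : ℕ) (A : Matrix (Fin (r + 1)) (Fin (n + 1)) R) : Submodule R (PluckerIndex r n → R) :=
  Submodule.span R {w | ∃ (S : Finset (Fin (r + 1))) (v : Fin (r + 1) → Fin (n + 1)),
    S.card ≤ m ∧ w = plucker (rowMix S (coordMatrix R v) A)}

/-- By multilinearity, restricting the replaced rows to basis vectors in `osc` loses nothing. -/
lemma plucker_rowMix_mem_osc {m : ℕ} {S : Finset (Fin (r + 1))} (hS : S.card ≤ m)
    (B A : Matrix (Fin (r + 1)) (Fin (n + 1)) R) : plucker (rowMix S B A) ∈ osc m A := by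
  -- `T` holds the replaced rows not yet expanded; the induction expands them one at a time.
  suffices H : ∀ T : Finset (Fin (r + 1)), T ⊆ S → ∀ B : Matrix (Fin (r + 1)) (Fin (n + 1)) R,
      (∀ i ∈ S \ T, ∃ v, B i = Pi.single v 1) → plucker (rowMix S B A) ∈ osc m A by
    exact H S subset_rfl B (by simp)
  intro T
  induction T using Finset.induction_on with
  | empty =>
    intro _ B hB
    have : ∀ i, ∃ v, i ∈ S → B i = Pi.single v 1 := by
      intro i
      by_cases hi : i ∈ S
      · obtain ⟨v, hv⟩ := hB i (by simpa using hi)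
        exact ⟨v, fun _ => hv⟩
      · exact ⟨0, fun h => absurd h hi⟩
    choose v hv using this
    refine Submodule.subset_span ⟨S, v, hS, ?_⟩
    congr 1
    ext i j
    by_cases hi : i ∈ S
    · simp [rowMix_apply, hi, hv i hi, coordMatrix]
    · simp [rowMix_apply, hi]
  | insert a T haT ih =>
    intro hT B hB
    have haS : a ∈ S := hT (Finset.mem_insert_self a T)
    have hup : ∀ x : Fin (n + 1) → R, (rowMix S B A).updateRow a x =
        rowMix S (B.updateRow a x) A := by
      intro x
      ext i j
      by_cases hia : i = a
      · subst hia; simp [rowMix_apply, haS]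
      · simp [rowMix_apply, Matrix.updateRow_ne hia]
    have h1 : rowMix S B A = (rowMix S B A).updateRow a (B a) := by
      rw [hup, Matrix.updateRow_eq_self]
    rw [h1, plucker_updateRow]
    refine Submodule.sum_mem _ fun c _ => Submodule.smul_mem _ _ ?_
    rw [hup]
    refine ih (fun i hi => hT (Finset.mem_insert_of_mem hi)) _ fun i hi => ?_
    by_cases hia : i = a
    · subst hia; exact ⟨c, Matrix.updateRow_self⟩
    · rw [Matrix.updateRow_ne hia]
      simp only [Finset.mem_sdiff, Finset.mem_insert] at hi hB
      exact hB i ⟨hi.1, by tauto⟩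

lemma rowMix_mul {a : ℕ} {κ κ' : Type*} [Fintype κ] (S : Finset (Fin a)) (B A : Matrix (Fin a) κ R)
    (M : Matrix κ κ' R) : rowMix S B A * M = rowMix S (B * M) (A * M) := by
  ext i j
  by_cases hi : i ∈ S <;> simp [rowMix_apply, hi, Matrix.mul_apply]

lemma osc_mul_compound_mem {m : ℕ} (A : Matrix (Fin (r + 1)) (Fin (n + 1)) R)
    (M : Matrix (Fin (n + 1)) (Fin (n + 1)) R) {w : PluckerIndex r n → R} (hw : w ∈ osc m A) :
    compound r M w ∈ osc m (A * M) := by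
  suffices H : osc m A ≤ (osc m (A * M)).comap (compound r M) from H hw
  refine Submodule.span_le.mpr ?_
  rintro _ ⟨S, v, hS, rfl⟩
  rw [SetLike.mem_coe, Submodule.mem_comap, compound_plucker, rowMix_mul]
  exact plucker_rowMix_mem_osc hS _ _

/-! ### Two estimates for determinants -/

/-- Each Leibniz term takes one entry from every column of `Q`, and at most `S.card` of these lie in
rows of `S`; the others are in `𝔞`. -/
lemma det_mem_pow {d : ℕ} (𝔞 : Ideal R) (A : Matrix (Fin d) (Fin d) R) (S Q : Finset (Fin d))
    (h : ∀ i ∉ S, ∀ j ∈ Q, A i j ∈ 𝔞) : A.det ∈ 𝔞 ^ (Q.card - S.card) := by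
  rw [Matrix.det_apply]
  refine Ideal.sum_mem _ fun σ _ => ?_
  refine Submodule.smul_of_tower_mem _ _ ?_
  have hsub : (Q \ S.preimage σ σ.injective.injOn) ⊆ Finset.univ := Finset.subset_univ _
  rw [← Finset.prod_sdiff hsub]
  refine Ideal.mul_mem_left _ _ ?_
  have h1 : ∏ j ∈ Q \ S.preimage σ σ.injective.injOn, A (σ j) j ∈
      𝔞 ^ (Q \ S.preimage σ σ.injective.injOn).card := by
    rw [← Finset.prod_const]
    refine Ideal.prod_mem_prod fun j hj => ?_
    simp only [Finset.mem_sdiff, Finset.mem_preimage] at hj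
    exact h _ hj.2 _ hj.1
  refine Ideal.pow_le_pow_right ?_ h1
  have h2 := Finset.le_card_sdiff (S.preimage σ σ.injective.injOn) Q
  have h3 : (S.preimage σ σ.injective.injOn).card = S.card := by
    rw [Finset.card_preimage]
    congr 1
    ext x; simp
  omega

lemma natDegree_det_le {d : ℕ} (A : Matrix (Fin d) (Fin d) (Polynomial R)) (S : Finset (Fin d))
    (h1 : ∀ i ∈ S, ∀ j, (A i j).natDegree ≤ 1) (h0 : ∀ i ∉ S, ∀ j, (A i j).natDegree = 0) :
    A.det.natDegree ≤ S.card := by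
  rw [← Matrix.det_transpose, Matrix.det_apply]
  refine Polynomial.natDegree_sum_le_of_forall_le _ _ fun σ _ => ?_
  refine (Polynomial.natDegree_smul_le _ _).trans ?_
  refine (Polynomial.natDegree_prod_le _ _).trans ?_
  calc ∑ i, (A.transpose (σ i) i).natDegree ≤ ∑ i, if i ∈ S then 1 else 0 := by
        refine Finset.sum_le_sum fun i _ => ?_
        split_ifs with hi
        · exact h1 i hi _
        · exact (h0 i hi _).le
    _ = S.card := by simp

/-- A unit vector at `J` is, up to sign, the wedge of the basis vectors of `J`, which differs from
the wedge over `u` in as many rows as `J` has elements outside `u`. -/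
lemma mem_osc_coordMatrix {K : Type*} [Field K] {m : ℕ} {u : Fin (r + 1) → Fin (n + 1)}
    (hu : Function.Injective u) {w : PluckerIndex r n → K}
    (hw : ∀ J : PluckerIndex r n, m < (J.1 \ Finset.univ.image u).card → w J = 0) :
    w ∈ osc m (coordMatrix K u) := by
  have hsum : w = ∑ J, w J • Pi.single J (1 : K) := by
    ext J; simp [Pi.single_apply]
  rw [hsum]
  refine Submodule.sum_mem _ fun J _ => ?_
  by_cases hJ : m < (J.1 \ Finset.univ.image u).card
  · simp [hw J hJ]
  refine Submodule.smul_mem _ _ ?_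
  push Not at hJ
  set S : Finset (Fin (r + 1)) := Finset.univ.filter fun i => u i ∉ J.1 with hSdef
  have hScard : S.card ≤ m := by
    have e1 : (S.image u) = Finset.univ.image u \ J.1 := by
      ext c; simp only [hSdef, Finset.mem_image, Finset.mem_filter, Finset.mem_univ, true_and,
        Finset.mem_sdiff]
      constructor
      · rintro ⟨i, hi, rfl⟩; exact ⟨⟨i, rfl⟩, hi⟩
      · rintro ⟨⟨i, rfl⟩, hi⟩; exact ⟨i, hi, rfl⟩
    have e2 := Finset.card_image_of_injective S hu
    have e3 : (Finset.univ.image u \ J.1).card = (J.1 \ Finset.univ.image u).card := by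
      apply Finset.card_sdiff_comm
      rw [Finset.card_image_of_injective _ hu, J.2]; simp
    rw [← e2, e1, e3]; exact hJ
  -- An enumeration of `J` that agrees with `u` wherever `u` already lands in `J`, so that only the
  -- rows in `S` change.
  obtain ⟨g, hg⟩ := Finset.exists_equiv_extend_of_card_eq (t := J.1)
    (by rw [J.2]; simp) (s := Finset.univ.filter fun i => u i ∈ J.1) (f := u)
    (by intro c; simp only [Finset.mem_image, Finset.mem_filter]; rintro ⟨i, hi, rfl⟩; exact hi.2)
    hu.injOn
  have hpl := plucker_rowMix_mem_osc (R := K) hScard (coordMatrix K fun i => (g i : Fin (n + 1)))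
    (coordMatrix K u)
  have hpw : rowMix S (coordMatrix K fun i => (g i : Fin (n + 1))) (coordMatrix K u) =
      coordMatrix K fun i => (g i : Fin (n + 1)) := by
    ext i c
    by_cases hi : i ∈ S
    · simp [rowMix_apply, hi]
    · have : u i ∈ J.1 := by simpa [hSdef] using hi
      simp [rowMix_apply, hi, coordMatrix, hg i (by simpa using this)]
  rw [hpw] at hpl
  have hne : plucker (coordMatrix K fun i => (g i : Fin (n + 1))) =
      plucker (coordMatrix K fun i => (g i : Fin (n + 1))) J • Pi.single J (1 : K) := by
    ext L
    by_cases hL : L = J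
    · subst hL; simp
    · simp only [Pi.smul_apply, Pi.single_eq_of_ne hL, smul_zero]
      obtain ⟨c, hc, hc'⟩ : ∃ c ∈ L.1, c ∉ J.1 := by
        by_contra! hcon
        exact hL (Subtype.ext (Finset.eq_of_subset_of_card_le hcon (by rw [J.2, L.2])))
      have : c ∈ Set.range (L.1.orderEmbOfFin L.2) := by
        rw [Finset.range_orderEmbOfFin]; exact hc
      obtain ⟨j, hj⟩ := this
      refine Matrix.det_eq_zero_of_column_eq_zero j fun i => ?_
      rw [Matrix.submatrix_apply, hj, coordMatrix, Matrix.of_apply, Pi.single_eq_of_ne]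
      rintro rfl
      exact hc' (g i).2
  have hunit : plucker (coordMatrix K fun i => (g i : Fin (n + 1))) J ≠ 0 := by
    let σ : Fin (r + 1) ≃ Fin (r + 1) := (J.1.orderIsoOfFin J.2).toEquiv.trans g.symm
    have : (coordMatrix K fun i => (g i : Fin (n + 1))).submatrix id (J.1.orderEmbOfFin J.2) =
        (1 : Matrix (Fin (r + 1)) (Fin (r + 1)) K).submatrix id σ := by
      ext i j
      simp only [coordMatrix, Matrix.submatrix_apply, Matrix.of_apply, Pi.single_apply, id,
        Matrix.one_apply]
      congr 1
      simp only [σ, Equiv.trans_apply, eq_iff_iff, Equiv.eq_symm_apply, Subtype.ext_iff]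
      exact eq_comm
    rw [plucker, this, Matrix.det_permute', Matrix.det_one, mul_one]
    rcases Int.units_eq_one_or (Equiv.Perm.sign σ) with h | h <;> simp [h]
  rw [hne] at hpl
  exact (Submodule.smul_mem_iff _ hunit).mp hpl

end Algebra

/-! ### Affine charts, and the identification of osculating spaces. -/

section Chart

variable {r n : ℕ} {R : Type*} [CommRing R]

/-- The increasing enumeration of an index set of Plücker coordinates. -/
abbrev indexEmb (I : PluckerIndex r n) : Fin (r + 1) ↪o Fin (n + 1) := I.1.orderEmbOfFin I.2

/-- The matrix whose entries are, up to sign, the Plücker coordinates indexed by the sets obtained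
from `I` by exchanging one element. -/
def chartMatrix (I : PluckerIndex r n) (x : PluckerIndex r n → R) :
    Matrix (Fin (r + 1)) (Fin (n + 1)) R :=
  Matrix.of fun i c => ∑ J, x J * (((1 : Matrix (Fin (n + 1)) (Fin (n + 1)) R).submatrix id
    (Function.update (indexEmb I) i c)).submatrix (indexEmb J) id).det

lemma chartMatrix_map {S : Type*} [CommRing S] (f : R →+* S) (I : PluckerIndex r n)
    (x : PluckerIndex r n → R) :
    (chartMatrix I x).map f = chartMatrix I fun J => f (x J) := by
  ext i c
  simp only [chartMatrix, Matrix.map_apply, Matrix.of_apply, map_sum, map_mul, RingHom.map_det]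
  refine Finset.sum_congr rfl fun J _ => ?_
  congr 2
  ext a b
  simp [Matrix.one_apply]

lemma chartMatrix_smul (I : PluckerIndex r n) (a : R) (x : PluckerIndex r n → R) :
    chartMatrix I (a • x) = a • chartMatrix I x := by
  ext i c
  simp only [chartMatrix, Matrix.of_apply, Matrix.smul_apply, Pi.smul_apply, smul_eq_mul,
    Finset.mul_sum, mul_assoc]

/-- By Cauchy–Binet the entry (i, c) is the minor of `A` on `I` with its i-th column replaced by
column c, and Cramer's rule applies. Thus a matrix is recovered linearly from Plücker coordinates,
up to row operations. -/
lemma chartMatrix_plucker (I : PluckerIndex r n) (A : Matrix (Fin (r + 1)) (Fin (n + 1)) R) :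
    chartMatrix I (plucker A) = (A.submatrix id (indexEmb I)).adjugate * A := by
  ext i c
  rw [chartMatrix, Matrix.of_apply, ← det_mul_eq_sum_plucker]
  have h1 : A * (1 : Matrix (Fin (n + 1)) (Fin (n + 1)) R).submatrix id
      (Function.update (indexEmb I) i c) =
      (A.submatrix id (indexEmb I)).updateCol i fun a => A a c := by
    ext a b
    have h2 : (A * (1 : Matrix (Fin (n + 1)) (Fin (n + 1)) R).submatrix id
        (Function.update (indexEmb I) i c)) a b = A a (Function.update (indexEmb I) i c b) := by
      simp [Matrix.mul_apply, Matrix.one_apply]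
    rw [h2]
    by_cases hb : b = i
    · subst hb; simp
    · simp [Function.update_of_ne hb, Matrix.updateCol_ne hb]
  rw [h1, ← Matrix.cramer_apply, Matrix.cramer_eq_adjugate_mulVec]
  rfl

lemma mem_affineCone_singleton {ι : Type} {p : ℙ ℂ (ι → ℂ)} {v x : ι → ℂ}
    (hv : v ∈ affineCone {p}) : x ∈ affineCone {p} ↔ ∃ a : ℂ, a ≠ 0 ∧ x = a • v := by
  obtain ⟨hv0, hv⟩ := hv
  rw [Set.mem_singleton_iff] at hv
  constructor
  · rintro ⟨hx0, hx⟩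
    rw [Set.mem_singleton_iff, ← hv, Projectivization.mk_eq_mk_iff'] at hx
    obtain ⟨a, ha⟩ := hx
    refine ⟨a, ?_, ha.symm⟩
    rintro rfl
    exact hx0 (by rw [← ha, zero_smul])
  · rintro ⟨a, ha, rfl⟩
    refine ⟨smul_ne_zero ha hv0, ?_⟩
    rw [Set.mem_singleton_iff, ← hv, Projectivization.mk_eq_mk_iff']
    exact ⟨a, rfl⟩

lemma linearIndependent_row_of_plucker_ne_zero {A : Matrix (Fin (r + 1)) (Fin (n + 1)) ℂ}
    (hA : plucker A ≠ 0) : LinearIndependent ℂ A.row := by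
  obtain ⟨J, hJ⟩ := Function.ne_iff.mp hA
  have h1 : LinearIndependent ℂ (A.submatrix id (indexEmb J)).row :=
    Matrix.linearIndependent_rows_of_det_ne_zero hJ
  exact LinearIndependent.of_comp (LinearMap.funLeft ℂ ℂ (indexEmb J)) h1

lemma mem_grassmannian_iff {p : ℙ ℂ (PluckerIndex r n → ℂ)} :
    p ∈ grassmannian r n ↔ ∃ A : Matrix (Fin (r + 1)) (Fin (n + 1)) ℂ,
      plucker A ∈ affineCone {p} :=
  ⟨fun ⟨A, _, hA⟩ => ⟨A, hA⟩,
    fun ⟨A, hA⟩ => ⟨A, linearIndependent_row_of_plucker_ne_zero hA.1, hA⟩⟩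

lemma mem_affineCone_grassmannian_iff {x : PluckerIndex r n → ℂ} :
    x ∈ affineCone (grassmannian r n) ↔ x ≠ 0 ∧
      ∃ (a : ℂ) (A : Matrix (Fin (r + 1)) (Fin (n + 1)) ℂ), x = a • plucker A := by
  constructor
  · rintro ⟨hx, hX⟩
    obtain ⟨A, hA⟩ := mem_grassmannian_iff.mp hX
    obtain ⟨a, -, ha⟩ := (mem_affineCone_singleton hA).mp ⟨hx, rfl⟩
    exact ⟨hx, a, A, ha⟩
  · rintro ⟨hx, a, A, rfl⟩
    refine ⟨hx, mem_grassmannian_iff.mpr ⟨A, ?_⟩⟩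
    have ha : a ≠ 0 := by rintro rfl; simp at hx
    rw [mem_affineCone_singleton (v := a • plucker A) ⟨hx, rfl⟩]
    exact ⟨a⁻¹, inv_ne_zero ha, by rw [smul_smul, inv_mul_cancel₀ ha, one_smul]⟩

/-- The exponent `r` comes from the determinant of the adjugate of a matrix of size r+1. -/
lemma plucker_chartMatrix (I : PluckerIndex r n) {x : PluckerIndex r n → ℂ}
    (hx : x ∈ affineCone (grassmannian r n)) :
    plucker (chartMatrix I x) = x I ^ r • x := by
  obtain ⟨-, a, A, rfl⟩ := mem_affineCone_grassmannian_iff.mp hx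
  rw [chartMatrix_smul, chartMatrix_plucker, ← Matrix.smul_mul, plucker_mul_left, Matrix.det_smul,
    Matrix.det_adjugate]
  simp only [Fintype.card_fin, Nat.add_sub_cancel, Pi.smul_apply, smul_eq_mul, smul_smul]
  congr 1
  change a ^ (r + 1) * plucker A I ^ r = _
  ring

lemma chartMatrix_submatrix (I : PluckerIndex r n) {x : PluckerIndex r n → ℂ}
    (hx : x ∈ affineCone (grassmannian r n)) :
    (chartMatrix I x).submatrix id (indexEmb I) = x I • 1 := by
  obtain ⟨-, a, A, rfl⟩ := mem_affineCone_grassmannian_iff.mp hx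
  rw [chartMatrix_smul, chartMatrix_plucker]
  have : (a • ((A.submatrix id (indexEmb I)).adjugate * A)).submatrix id (indexEmb I) =
      a • ((A.submatrix id (indexEmb I)).adjugate * A.submatrix id (indexEmb I)) := rfl
  rw [this, Matrix.adjugate_mul, smul_smul]
  rfl

/-! ### Osculating spaces of Grassmannians -/

/-- The generators of `osc` are images of generators over `R`. This lets a form annihilating `osc`
over ℂ be used with polynomial replacement rows. -/
lemma sum_map_mul_eq_zero_of_mem_osc {S : Type*} [CommRing S] (f : R →+* S) {m : ℕ}
    {A : Matrix (Fin (r + 1)) (Fin (n + 1)) R} {c : PluckerIndex r n → R}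
    (hc : ∀ w ∈ osc m A, ∑ K, c K * w K = 0) {z : PluckerIndex r n → S}
    (hz : z ∈ osc m (A.map f)) : ∑ K, f (c K) * z K = 0 := by
  let φ : (PluckerIndex r n → S) →ₗ[S] S := Fintype.linearCombination S fun K => f (c K)
  have hφ : ∀ z, φ z = ∑ K, f (c K) * z K := fun z => by
    simp [φ, Fintype.linearCombination_apply, mul_comm]
  suffices H : osc m (A.map f) ≤ LinearMap.ker φ by rw [← hφ]; exact H hz
  refine Submodule.span_le.mpr ?_
  rintro _ ⟨T, v, hT, rfl⟩
  rw [SetLike.mem_coe, LinearMap.mem_ker, hφ]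
  have h1 : rowMix T (coordMatrix S v) (A.map f) = (rowMix T (coordMatrix R v) A).map f := by
    ext i j
    by_cases hi : i ∈ T <;> simp [rowMix_apply, hi, coordMatrix_apply, apply_ite f]
  simp only [h1, plucker_map, ← map_mul, ← map_sum]
  rw [hc _ (plucker_rowMix_mem_osc hT _ _), map_zero]

lemma plucker_rowMix_smul (S : Finset (Fin (r + 1))) (a : R)
    (B A : Matrix (Fin (r + 1)) (Fin (n + 1)) R) :
    ∃ b : R, plucker (rowMix S B (a • A)) = b • plucker (rowMix S B A) := by
  refine ⟨_, (congrArg plucker ?_).trans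
    (plucker_mul_left (Matrix.diagonal fun i => if i ∈ S then 1 else a) _)⟩
  ext i j
  by_cases hi : i ∈ S <;> simp [rowMix_apply, hi]

lemma plucker_add (A B : Matrix (Fin (r + 1)) (Fin (n + 1)) R) :
    plucker (A + B) = ∑ S : Finset (Fin (r + 1)), plucker (rowMix S A B) := by
  have h := (pluckerAlternating r n R).map_add_univ A B
  refine h.trans (Finset.sum_congr rfl fun S _ => ?_)
  rw [← pluckerAlternating_apply (rowMix S A B)]
  congr 1
  refine funext fun i => funext fun j => ?_
  rw [rowMix_apply]
  by_cases hi : i ∈ S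
  · rw [if_pos hi]; exact congrFun (Finset.piecewise_eq_of_mem S _ _ hi) j
  · rw [if_neg hi]; exact congrFun (Finset.piecewise_eq_of_notMem S _ _ hi) j

lemma eval_linearForm {ι : Type} [Fintype ι] (c x : ι → ℂ) :
    MvPolynomial.eval x (linearForm c) = ∑ i, c i * x i := by
  simp [linearForm]

lemma mem_homogeneousIdealOf {ι : Type} {X : Set (ℙ ℂ (ι → ℂ))} {F : MvPolynomial ι ℂ} :
    F ∈ homogeneousIdealOf X ↔ ∀ x ∈ affineCone X, MvPolynomial.eval x F = 0 := by
  simp only [homogeneousIdealOf, MvPolynomial.mem_vanishingIdeal_iff, MvPolynomial.aeval_eq_eval]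

/-- Taylor expansion in the chart at `I`: expand the wedge of rows "fixed + deviation"
multilinearly. Terms with at most `m` deviations are annihilated by `c`, and the rest lie in the
(m+1)-st power of the ideal of `p`. -/
lemma vanishesToOrder_linearForm {m : ℕ} {p : ℙ ℂ (PluckerIndex r n → ℂ)}
    {A : Matrix (Fin (r + 1)) (Fin (n + 1)) ℂ} (hA : plucker A ∈ affineCone {p})
    {c : PluckerIndex r n → ℂ} (hc : ∀ w ∈ osc m A, ∑ K, c K * w K = 0) :
    VanishesToOrder (grassmannian r n) p (m + 1) (linearForm c) := by
  obtain ⟨I, hI⟩ := Function.ne_iff.mp hA.1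
  rw [Pi.zero_apply] at hI
  let AI : Matrix (Fin (r + 1)) (Fin (r + 1)) ℂ := A.submatrix id (indexEmb I)
  let AIC : Matrix (Fin (r + 1)) (Fin (r + 1)) (MvPolynomial (PluckerIndex r n) ℂ) :=
    AI.map MvPolynomial.C
  -- The universal matrix of the chart, normalized so that at `p` it agrees with `XA`, the multiple
  -- of `A` by the coordinate `I`.
  let Y : Matrix (Fin (r + 1)) (Fin (n + 1)) (MvPolynomial (PluckerIndex r n) ℂ) :=
    AIC * chartMatrix (R := MvPolynomial (PluckerIndex r n) ℂ) I MvPolynomial.X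
  let XA : Matrix (Fin (r + 1)) (Fin (n + 1)) (MvPolynomial (PluckerIndex r n) ℂ) :=
    (MvPolynomial.X I : MvPolynomial (PluckerIndex r n) ℂ) • A.map MvPolynomial.C
  have hYeval : ∀ x, Y.map (MvPolynomial.eval x) = AI * chartMatrix I x := by
    intro x
    simp only [Y]
    rw [Matrix.map_mul, chartMatrix_map]
    congr 1
    · ext; simp [AIC]
    · simp
  have hD : ∀ i j, (Y - XA) i j ∈ homogeneousIdealOf {p} := by
    intro i j
    rw [mem_homogeneousIdealOf]
    intro x hx
    obtain ⟨a, -, rfl⟩ := (mem_affineCone_singleton hA).mp hx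
    have h0 := hYeval (a • plucker A)
    rw [chartMatrix_smul, chartMatrix_plucker, Matrix.mul_smul, ← Matrix.mul_assoc,
      Matrix.mul_adjugate] at h0
    have h1 := Matrix.ext_iff.mpr h0 i j
    rw [Matrix.sub_apply, map_sub, sub_eq_zero]
    refine h1.trans ?_
    simp only [XA, Matrix.smul_apply, Matrix.map_apply, smul_eq_mul, map_mul,
      MvPolynomial.eval_X, MvPolynomial.eval_C, Matrix.smul_mul, Matrix.one_mul, Pi.smul_apply,
      mul_assoc]
    rfl
  -- The factor by which the Plücker vector of `Y` differs, on the cone over the Grassmannian, from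
  -- the tautological vector.
  refine ⟨MvPolynomial.C AI.det * MvPolynomial.X I ^ r, ?_, ?_⟩
  · rw [mem_homogeneousIdealOf]
    intro h
    have := h _ hA
    simp only [map_mul, MvPolynomial.eval_C, map_pow, MvPolynomial.eval_X] at this
    exact mul_ne_zero hI (pow_ne_zero r hI) this
  · have hsplit : MvPolynomial.C AI.det * MvPolynomial.X I ^ r * linearForm c =
        (∑ K, MvPolynomial.C (c K) * plucker Y K) +
        (MvPolynomial.C AI.det * MvPolynomial.X I ^ r * linearForm c -
          ∑ K, MvPolynomial.C (c K) * plucker Y K) := by ring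
    rw [hsplit]
    refine Submodule.add_mem_sup ?_ ?_
    · have hY : Y = (Y - XA) + XA := by rw [sub_add_cancel]
      rw [hY, plucker_add]
      simp only [Finset.sum_apply, Finset.mul_sum]
      rw [Finset.sum_comm]
      refine Ideal.sum_mem _ fun S _ => ?_
      by_cases hS : S.card ≤ m
      · obtain ⟨b, hb⟩ := plucker_rowMix_smul S (MvPolynomial.X I : MvPolynomial (PluckerIndex r n) ℂ)
          (Y - XA) (A.map MvPolynomial.C)
        have h0 := sum_map_mul_eq_zero_of_mem_osc MvPolynomial.C hc
          (plucker_rowMix_mem_osc hS (Y - XA) (A.map MvPolynomial.C))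
        have : ∑ K, MvPolynomial.C (c K) * plucker (rowMix S (Y - XA) XA) K = 0 := by
          rw [hb]
          simp only [Pi.smul_apply, smul_eq_mul, mul_left_comm _ b, ← Finset.mul_sum]
          rw [h0, mul_zero]
        rw [this]
        exact zero_mem _
      · refine Ideal.sum_mem _ fun K _ => Ideal.mul_mem_left _ _ ?_
        have h1 := det_mem_pow (homogeneousIdealOf {p})
          ((rowMix S (Y - XA) XA).submatrix id (indexEmb K)) Sᶜ Finset.univ (by
            intro i hi j _
            rw [Finset.mem_compl, not_not] at hi
            rw [Matrix.submatrix_apply, rowMix_apply, id, if_pos hi]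
            exact hD _ _)
        refine Ideal.pow_le_pow_right ?_ h1
        have := S.card_compl
        have h3 := S.card_le_univ
        simp only [Fintype.card_fin, Finset.card_univ] at this h3 ⊢
        omega
    · rw [mem_homogeneousIdealOf]
      intro x hx
      have h1 : ∀ K, MvPolynomial.eval x (plucker Y K) = AI.det * (x I ^ r * x K) := by
        intro K
        rw [← plucker_map, hYeval, plucker_mul_left, plucker_chartMatrix I hx]
        rfl
      simp only [map_sub, map_mul, map_sum, MvPolynomial.eval_C, map_pow, MvPolynomial.eval_X,
        eval_linearForm, h1, Finset.mul_sum, sub_eq_zero]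
      exact Finset.sum_congr rfl fun K _ => by ring

/-- Restrict the form to an arc moving only the rows in `S` from `A` to `B`: the result has degree
at most `m` but vanishes to order m+1 at 0, so it is zero; then evaluate at 1. -/
lemma sum_mul_eq_zero_of_vanishesToOrder {m : ℕ} {p : ℙ ℂ (PluckerIndex r n → ℂ)}
    {A : Matrix (Fin (r + 1)) (Fin (n + 1)) ℂ} (hA : plucker A ∈ affineCone {p})
    {c : PluckerIndex r n → ℂ}
    (hc : VanishesToOrder (grassmannian r n) p (m + 1) (linearForm c))
    {S : Finset (Fin (r + 1))} (hS : S.card ≤ m) (B : Matrix (Fin (r + 1)) (Fin (n + 1)) ℂ) :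
    ∑ K, c K * plucker (rowMix S B A) K = 0 := by
  obtain ⟨G, hG, hGF⟩ := hc
  rw [mem_homogeneousIdealOf] at hG
  push Not at hG
  obtain ⟨x, hx, hGx⟩ := hG
  obtain ⟨a, ha, rfl⟩ := (mem_affineCone_singleton hA).mp hx
  let Z : Matrix (Fin (r + 1)) (Fin (n + 1)) (Polynomial ℂ) :=
    rowMix S (Matrix.of fun i j => Polynomial.C (A i j) * (1 - Polynomial.X) +
      Polynomial.C (B i j) * Polynomial.X) (A.map Polynomial.C)
  let φ : MvPolynomial (PluckerIndex r n) ℂ →ₐ[ℂ] Polynomial ℂ :=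
    MvPolynomial.aeval fun K => Polynomial.C a * plucker Z K
  have hZ : ∀ s : ℂ, Z.map (Polynomial.evalRingHom s) =
      rowMix S (Matrix.of fun i j => A i j * (1 - s) + B i j * s) A := by
    intro s
    ext i j
    by_cases hi : i ∈ S <;> simp [Z, rowMix_apply, hi]
  have hφ : ∀ (s : ℂ) F, (φ F).eval s =
      MvPolynomial.eval (a • plucker (Z.map (Polynomial.evalRingHom s))) F := by
    intro s F
    rw [← Polynomial.coe_evalRingHom, ← MvPolynomial.coe_aeval_eq_eval]
    have : ((Polynomial.aeval s).comp φ) =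
        (MvPolynomial.aeval (a • plucker (Z.map (Polynomial.evalRingHom s)))) := by
      refine MvPolynomial.algHom_ext fun K => ?_
      simp only [AlgHom.comp_apply, φ, MvPolynomial.aeval_X, Pi.smul_apply, plucker_map]
      simp
    exact congrFun (congrArg DFunLike.coe this) F
  have hZ0 : Z.map (Polynomial.evalRingHom 0) = A := by
    rw [hZ]; ext i j; simp [rowMix_apply]
  have hIp : homogeneousIdealOf {p} ≤ (Ideal.span {Polynomial.X}).comap φ := by
    intro H hH
    rw [Ideal.mem_comap, Ideal.mem_span_singleton, Polynomial.X_dvd_iff,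
      Polynomial.coeff_zero_eq_eval_zero, hφ, hZ0]
    exact mem_homogeneousIdealOf.mp hH _ hx
  have hIX : ∀ H ∈ homogeneousIdealOf (grassmannian r n), φ H = 0 := by
    intro H hH
    obtain ⟨I, hI⟩ := Function.ne_iff.mp hA.1
    rw [Pi.zero_apply] at hI
    -- The arc may pass through dependent rows, where it leaves the cone; multiplying by a
    -- coordinate that is not identically zero discards those parameters.
    have hne : plucker Z I ≠ 0 := by
      intro h0
      apply hI
      rw [← hZ0, plucker_map, h0, map_zero]
    refine (mul_eq_zero.mp (?_ : plucker Z I * φ H = 0)).resolve_left hne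
    refine Polynomial.funext fun s => ?_
    rw [Polynomial.eval_mul, Polynomial.eval_zero, mul_eq_zero, or_iff_not_imp_left]
    intro hs
    rw [hφ]
    refine mem_homogeneousIdealOf.mp hH _ (mem_affineCone_grassmannian_iff.mpr ⟨?_, a, _, rfl⟩)
    refine smul_ne_zero ha fun h0 => hs ?_
    rw [← Polynomial.coe_evalRingHom, ← plucker_map, h0, Pi.zero_apply]
  have hdvd : (Polynomial.X : Polynomial ℂ) ^ (m + 1) ∣ φ (linearForm c) := by
    have h1 : φ (G * linearForm c) ∈ Ideal.span {(Polynomial.X : Polynomial ℂ) ^ (m + 1)} := by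
      obtain ⟨u, hu, v, hv, huv⟩ := Submodule.mem_sup.mp hGF
      rw [← huv, map_add, hIX v hv, add_zero, ← Ideal.span_singleton_pow]
      exact Ideal.le_comap_pow φ (m + 1) (Ideal.pow_right_mono hIp _ hu)
    rw [Ideal.mem_span_singleton, map_mul] at h1
    refine IsCoprime.dvd_of_dvd_mul_left (IsCoprime.pow_left ?_) h1
    rw [Irreducible.coprime_iff_not_dvd Polynomial.irreducible_X, Polynomial.X_dvd_iff,
      Polynomial.coeff_zero_eq_eval_zero, hφ, hZ0]
    exact hGx
  have hlin : φ (linearForm c) = ∑ K, Polynomial.C (c K) * (Polynomial.C a * plucker Z K) := by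
    simp only [φ, linearForm, map_sum, map_mul, MvPolynomial.aeval_X, MvPolynomial.algHom_C]
    rfl
  have hdeg : (φ (linearForm c)).natDegree ≤ m := by
    rw [hlin]
    refine Polynomial.natDegree_sum_le_of_forall_le _ _ fun K _ => ?_
    refine (Polynomial.natDegree_C_mul_le _ _).trans ((Polynomial.natDegree_C_mul_le _ _).trans ?_)
    refine (natDegree_det_le _ S ?_ ?_).trans hS
    · intro i hi j
      simp only [Z, Matrix.submatrix_apply, rowMix_apply, if_pos hi, Matrix.of_apply, id]
      compute_degree
    · intro i hi j
      simp [Z, rowMix_apply, hi]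
  have hzero : φ (linearForm c) = 0 := by
    by_contra hne
    have := Polynomial.natDegree_le_of_dvd hdvd hne
    rw [Polynomial.natDegree_X_pow] at this
    omega
  have h1 : MvPolynomial.eval (a • plucker (rowMix S B A)) (linearForm c) = 0 := by
    have := hφ 1 (linearForm c)
    rw [hzero, Polynomial.eval_zero, hZ] at this
    have h2 : (Matrix.of fun i j => A i j * (1 - 1) + B i j * 1) = B := by ext; simp
    rw [h2] at this
    exact this.symm
  rw [eval_linearForm] at h1
  simp only [Pi.smul_apply, smul_eq_mul, mul_left_comm _ a, ← Finset.mul_sum] at h1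
  exact (mul_eq_zero.mp h1).resolve_left ha

theorem osculatingSpace_grassmannian (m : ℕ) {p : ℙ ℂ (PluckerIndex r n → ℂ)}
    {A : Matrix (Fin (r + 1)) (Fin (n + 1)) ℂ} (hA : plucker A ∈ affineCone {p}) :
    osculatingSpace (grassmannian r n) m p = osc m A := by
  have hker : ∀ c w : PluckerIndex r n → ℂ,
      w ∈ LinearMap.ker (Fintype.linearCombination ℂ c) ↔ ∑ K, c K * w K = 0 := by
    intro c w
    simp [Fintype.linearCombination_apply, mul_comm]
  apply le_antisymm
  · intro w hw
    by_contra hcon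
    obtain ⟨f, hf, hle⟩ := Submodule.exists_le_ker_of_notMem hcon
    have hfs : ∀ z, f z = ∑ K, f (Pi.single K 1) * z K := by
      intro z
      conv_lhs => rw [show z = ∑ K, z K • Pi.single K (1 : ℂ) by ext J; simp [Pi.single_apply]]
      simp [mul_comm]
    have hv : VanishesToOrder (grassmannian r n) p (m + 1)
        (linearForm fun K => f (Pi.single K 1)) :=
      vanishesToOrder_linearForm hA fun z hz => by rw [← hfs]; exact hle hz
    simp only [osculatingSpace, Submodule.mem_iInf] at hw
    have := hw _ hv
    rw [hker, ← hfs] at this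
    exact hf this
  · simp only [osculatingSpace, le_iInf_iff]
    intro c hc
    refine Submodule.span_le.mpr ?_
    rintro _ ⟨S, v, hS, rfl⟩
    rw [SetLike.mem_coe, hker]
    exact sum_mul_eq_zero_of_vanishesToOrder hA hc hS _

end Chart

/-! ### Existence of flat limits over the affine line. -/

section FlatLimit

open Polynomial

/-- The saturation of a submodule: the vectors with a nonzero multiple in it. -/
def saturation {R M : Type*} [CommRing R] [IsDomain R] [AddCommGroup M] [Module R M]
    (P : Submodule R M) : Submodule R M where
  carrier := {w | ∃ f : R, f ≠ 0 ∧ f • w ∈ P}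
  zero_mem' := ⟨1, one_ne_zero, by simp⟩
  add_mem' := by
    rintro a b ⟨f, hf, ha⟩ ⟨g, hg, hb⟩
    refine ⟨f * g, mul_ne_zero hf hg, ?_⟩
    rw [smul_add, mul_smul, mul_smul, smul_comm f g a]
    exact P.add_mem (P.smul_mem _ ha) (P.smul_mem _ hb)
  smul_mem' := by
    rintro c a ⟨f, hf, ha⟩
    exact ⟨f, hf, by rw [smul_comm]; exact P.smul_mem _ ha⟩

lemma closedPoint_apply (t : ClosedPoints ℂ[X]) (f : ℂ[X]) : t f = f.eval (t X) := by
  rw [← Polynomial.coe_aeval_eq_eval, Polynomial.aeval_algHom_apply, Polynomial.aeval_X_left]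
  rfl

lemma closedPoint_eq (t : ClosedPoints ℂ[X]) : t = affineLinePoint (affineLineCoord t) := by
  refine AlgHom.ext fun f => ?_
  rw [closedPoint_apply]
  simp [affineLinePoint, affineLineCoord, Polynomial.coe_aeval_eq_eval]

/-- Families of linear spaces over the affine line, with polynomial frames, have flat limits. -/
theorem exists_isFlatLimit {ι : Type} [Finite ι] (P : Submodule ℂ[X] (ι → ℂ[X])) {h₀ : ℂ[X]}
    (hh₀ : h₀.eval 0 ≠ 0) (W : ClosedPoints ℂ[X] → Submodule ℂ (ι → ℂ))
    (hW : ∀ t : ClosedPoints ℂ[X], t h₀ ≠ 0 →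
      W t = Submodule.span ℂ ((fun (w : ι → ℂ[X]) i => t (w i)) '' P))
    (L : Submodule ℂ (ι → ℂ))
    (hL : ∀ (w : ι → ℂ[X]) (f : ℂ[X]), f ≠ 0 → f • w ∈ P → (fun i => (w i).eval 0) ∈ L) :
    ∃ T₀, IsFlatLimit (affineLinePoint 0) W T₀ ∧ T₀ ≤ L := by
  classical
  cases nonempty_fintype ι
  -- Saturating is what keeps the frame independent in every fibre, including that at 0, where
  -- generators of `P` may degenerate.
  obtain ⟨d, b⟩ := Submodule.basisOfPid (Pi.basisFun ℂ[X] ι) (saturation P)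
  have hbs : ∀ j, ∃ f : ℂ[X], f ≠ 0 ∧ f • (b j : ι → ℂ[X]) ∈ P := fun j => (b j).2
  choose f hf hfP using hbs
  have hF : ∏ j, f j ≠ 0 := Finset.prod_ne_zero_iff.mpr fun j _ => hf j
  -- The denominators may vanish at 0, where the fibre of `P` is not compared with the frame; only
  -- their zeros elsewhere, those of `q`, are removed.
  obtain ⟨q, hFq, hq⟩ := Polynomial.exists_eq_pow_rootMultiplicity_mul_and_not_dvd _ hF 0
  have hq0 : q.eval 0 ≠ 0 := by
    intro h0
    exact hq (Polynomial.dvd_iff_isRoot.mpr h0)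
  have hexp : ∀ w (hw : w ∈ saturation P), ∃ g : Fin d → ℂ[X],
      w = ∑ j, g j • (b j : ι → ℂ[X]) := by
    intro w hw
    refine ⟨b.repr ⟨w, hw⟩, ?_⟩
    have := congrArg (saturation P).subtype (b.sum_repr ⟨w, hw⟩)
    rw [map_sum] at this
    exact this.symm
  refine ⟨_, ⟨h₀ * q, d, fun j => b j, ?_, ?_, ?_, rfl⟩, ?_⟩
  · rw [map_mul]
    exact mul_ne_zero (by simpa [affineLinePoint, Polynomial.coe_aeval_eq_eval] using hh₀)
      (by simpa [affineLinePoint, Polynomial.coe_aeval_eq_eval] using hq0)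
  · intro t _
    rw [Fintype.linearIndependent_iff]
    intro c hc
    have hdvd : ∀ i, (X - C (t X)) ∣ ∑ j, C (c j) * (b j : ι → ℂ[X]) i := by
      intro i
      rw [Polynomial.dvd_iff_isRoot, Polynomial.IsRoot.def, ← closedPoint_apply, map_sum]
      have := congrFun hc i
      simp only [Finset.sum_apply, Pi.smul_apply, smul_eq_mul, Pi.zero_apply] at this
      rw [← this]
      refine Finset.sum_congr rfl fun j _ => ?_
      rw [map_mul, closedPoint_apply t (C _), eval_C]
    choose u hu using hdvd
    have hu' : ∑ j, C (c j) • (b j : ι → ℂ[X]) = (X - C (t X)) • u := by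
      ext1 i
      simp [hu i]
    -- A relation in the fibre at `t` makes a combination of the frame divisible by X - t; the
    -- quotient is again in the saturation, contradicting freeness unless all coefficients vanish.
    have hus : u ∈ saturation P := by
      have hmem : (X - C (t X)) • u ∈ saturation P := by
        rw [← hu']
        exact Submodule.sum_mem _ fun j _ => Submodule.smul_mem _ _ (b j).2
      obtain ⟨g, hg, hgm⟩ := hmem
      exact ⟨g * (X - C (t X)), mul_ne_zero hg (Polynomial.X_sub_C_ne_zero _), by
        rwa [mul_smul]⟩
    obtain ⟨g, hg⟩ := hexp u hus
    have hrel : ∑ j, (C (c j) - (X - C (t X)) * g j) • b j = 0 := by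
      have h0 : ∑ j, (C (c j) - (X - C (t X)) * g j) • b j =
          ∑ j, C (c j) • b j - (X - C (t X)) • ∑ j, g j • b j := by
        rw [Finset.smul_sum, ← Finset.sum_sub_distrib]
        exact Finset.sum_congr rfl fun j _ => by
          rw [sub_smul (C (c j)) _ (b j), mul_smul]
      rw [h0]
      apply Subtype.ext
      have h1 : ((∑ j, C (c j) • b j : saturation P) : ι → ℂ[X]) = (X - C (t X)) • u := by
        rw [← hu']; simp
      have h2 : ((∑ j, g j • b j : saturation P) : ι → ℂ[X]) = u := by
        rw [hg]; simp
      rw [Submodule.coe_sub, h1, Submodule.coe_smul, h2, sub_self]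
      rfl
    intro j
    have := Fintype.linearIndependent_iff.mp b.linearIndependent _ hrel j
    have := congrArg (Polynomial.eval (t X)) this
    simpa using this
  · intro t ht htne
    rw [map_mul] at ht
    have hX : t X ≠ 0 := by
      intro h0
      apply htne
      rw [closedPoint_eq t, affineLineCoord, h0]
    have hft : ∀ j, t (f j) ≠ 0 := by
      have : t (∏ j, f j) ≠ 0 := by
        rw [hFq, map_mul, map_pow]
        refine mul_ne_zero (pow_ne_zero _ ?_) (right_ne_zero_of_mul ht)
        simpa using hX
      rw [map_prod] at this
      exact fun j => Finset.prod_ne_zero_iff.mp this j (Finset.mem_univ j)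
    rw [hW t (left_ne_zero_of_mul ht)]
    apply le_antisymm
    · refine Submodule.span_le.mpr ?_
      rintro _ ⟨w, hw, rfl⟩
      obtain ⟨g, hg⟩ := hexp w ⟨1, one_ne_zero, by simpa using hw⟩
      have : (fun i => t (w i)) = ∑ j, t (g j) • fun i => t ((b j : ι → ℂ[X]) i) := by
        ext i
        rw [hg]
        simp
      rw [SetLike.mem_coe]
      simp only [this]
      exact Submodule.sum_mem _ fun j _ => Submodule.smul_mem _ _
        (Submodule.subset_span ⟨j, rfl⟩)
    · refine Submodule.span_le.mpr ?_
      rintro _ ⟨j, rfl⟩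
      refine (Submodule.smul_mem_iff _ (hft j)).mp (Submodule.subset_span ⟨_, hfP j, ?_⟩)
      ext i
      simp
  · refine Submodule.span_le.mpr ?_
    rintro _ ⟨j, rfl⟩
    simpa [affineLinePoint, Polynomial.coe_aeval_eq_eval] using hL _ _ (hf j) (hfP j)

end FlatLimit

/-! ### The shear argument: degree against order of vanishing. -/

section Degeneration

open Polynomial

variable {r n : ℕ}

lemma card_filter_indexEmb (J : PluckerIndex r n) {T : Finset (Fin (n + 1))} (hT : T ⊆ J.1) :
    (Finset.univ.filter fun b => indexEmb J b ∈ T).card = T.card := by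
  rw [← Finset.card_image_of_injective _ (indexEmb J).injective]
  congr 1
  ext c
  simp only [Finset.mem_image, Finset.mem_filter, Finset.mem_univ, true_and]
  constructor
  · rintro ⟨b, hb, rfl⟩; exact hb
  · intro hc
    have : c ∈ Set.range (indexEmb J) := by
      rw [Finset.range_orderEmbOfFin]; exact hT hc
    obtain ⟨b, rfl⟩ := this
    exact ⟨b, hc, rfl⟩

/-- A polynomial family of endomorphisms of `ℂ^(n+1)` which, up to the scalar `δ`, is the
identity for the parameters `B = 0` and `X = 0`. -/
def shearMatrix {R : Type*} [CommRing R] (u : Fin (r + 1) → Fin (n + 1)) (δ : R)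
    (B : Matrix (Fin (r + 1)) (Fin (n + 1)) R) (Q : Finset (Fin (n + 1))) :
    Matrix (Fin (n + 1)) (Fin (n + 1)) R[X] :=
  Matrix.of fun a c => (if a = c then C δ * (if c ∈ Q then 1 + X else 1) else 0) -
    ∑ i, if a = u i then C (B i c) else 0

lemma mul_shearMatrix {R : Type*} [CommRing R] (u : Fin (r + 1) → Fin (n + 1)) (δ : R)
    (B : Matrix (Fin (r + 1)) (Fin (n + 1)) R) (Q : Finset (Fin (n + 1)))
    (A : Matrix (Fin (r + 1)) (Fin (n + 1)) R) (i : Fin (r + 1)) (c : Fin (n + 1)) :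
    (A.map C * shearMatrix u δ B Q) i c =
      C (A i c) * (C δ * (if c ∈ Q then 1 + X else 1)) - C (∑ a, A i (u a) * B a c) := by
  rw [Matrix.mul_apply]
  simp only [shearMatrix, Matrix.map_apply, Matrix.of_apply, mul_sub, Finset.sum_sub_distrib,
    mul_ite, mul_zero, Finset.sum_ite_eq', Finset.mem_univ, if_true, Finset.mul_sum]
  congr 1
  rw [Finset.sum_comm]
  simp

/-- In the first case the unreplaced rows are zero in `Q`, so only the at most `k` rows in `S`
involve the variable. In the second, unreplaced rows become divisible by it in every column of `J`
outside `u`, so its power k+2 divides the minor. -/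
lemma coeff_det_shear_eq_zero {R : Type*} [CommRing R] {k k' : ℕ}
    {u : Fin (r + 1) → Fin (n + 1)} (hu : Function.Injective u) (δ : R)
    {B : Matrix (Fin (r + 1)) (Fin (n + 1)) R} {Q : Finset (Fin (n + 1))} (hQu : ∀ i, u i ∉ Q)
    (hB : ∀ a, ∀ c ∉ Q, B a c = 0) {J : PluckerIndex r n}
    (hJ : k + k' + 1 < (J.1 \ Finset.univ.image u).card)
    {S : Finset (Fin (r + 1))} (A A' : Matrix (Fin (r + 1)) (Fin (n + 1)) R)
    (hA : (S.card ≤ k ∧ ∀ i, ∀ c ∈ Q, A i c = 0) ∨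
      (S.card ≤ k' ∧ A = δ • coordMatrix R u + B)) :
    (((rowMix S A' A).map C * shearMatrix u δ B Q).submatrix id (indexEmb J)).det.coeff (k + 1)
      = 0 := by
  rcases hA with ⟨hS, hA⟩ | ⟨hS, rfl⟩
  · refine Polynomial.coeff_eq_zero_of_natDegree_lt (lt_of_le_of_lt
      (natDegree_det_le _ S ?_ ?_) (Nat.lt_succ_of_le hS))
    · intro i _ b
      rw [Matrix.submatrix_apply, mul_shearMatrix]
      split_ifs
      · compute_degree
      · rw [mul_one, ← C_mul, ← C_sub, natDegree_C]; exact Nat.zero_le _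
    · intro i hi b
      rw [Matrix.submatrix_apply, mul_shearMatrix, rowMix_apply, id, if_neg hi]
      split_ifs with hc
      · rw [hA i _ hc, C_0, zero_mul, zero_sub, natDegree_neg, natDegree_C]
      · rw [mul_one, ← C_mul, ← C_sub, natDegree_C]
  · have h1 := det_mem_pow (Ideal.span {(X : R[X])})
      (((rowMix S A' (δ • coordMatrix R u + B)).map C * shearMatrix u δ B Q).submatrix id
        (indexEmb J)) S
      (Finset.univ.filter fun b => indexEmb J b ∈ J.1 \ Finset.univ.image u) (by
        intro i hi b hb
        simp only [Finset.mem_filter, Finset.mem_univ, true_and, Finset.mem_sdiff,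
          Finset.mem_image, not_exists] at hb
        have hE : coordMatrix R u i (indexEmb J b) = 0 := by
          rw [coordMatrix_apply, if_neg fun h => hb.2 i h.symm]
        have hsum : ∑ a, (δ • coordMatrix R u + B) i (u a) * B a (indexEmb J b) =
            δ * B i (indexEmb J b) := by
          rw [Finset.sum_eq_single i]
          · simp [coordMatrix_apply, hB i _ (hQu i)]
          · intro a _ ha
            simp [coordMatrix_apply, hB i _ (hQu a), hu.ne ha]
          · simp
        rw [Matrix.submatrix_apply, mul_shearMatrix]
        simp only [rowMix_apply, id, if_neg hi]
        rw [hsum, Matrix.add_apply, Matrix.smul_apply, hE, smul_zero, zero_add,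
          Ideal.mem_span_singleton]
        split_ifs with hc
        · exact ⟨C (δ * B i (indexEmb J b)), by rw [C_mul]; ring⟩
        · simp [hB i _ hc])
    rw [card_filter_indexEmb J Finset.sdiff_subset, Ideal.span_singleton_pow,
      Ideal.mem_span_singleton] at h1
    exact Polynomial.X_pow_dvd_iff.mp h1 _ (by omega)

/-- Without `B` the shear is diagonal, and the minor is a power of `δ` times (1 + X) to the number
of elements of `J` in `Q`. -/
lemma coeff_det_shear_zero {k : ℕ} (u : Fin (r + 1) → Fin (n + 1)) (δ : ℂ)
    (Q : Finset (Fin (n + 1))) (K J : PluckerIndex r n) :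
    ((shearMatrix u δ 0 Q).submatrix (indexEmb K) (indexEmb J)).det.coeff (k + 1) =
      if K = J then δ ^ (r + 1) * ((J.1 ∩ Q).card.choose (k + 1) : ℂ) else 0 := by
  have hM : shearMatrix u δ 0 Q =
      Matrix.diagonal fun c => C δ * (if c ∈ Q then 1 + X else 1) := by
    ext a c : 2
    by_cases hac : a = c
    · subst hac; simp [shearMatrix]
    · simp [shearMatrix, hac]
  rw [hM]
  split_ifs with hKJ
  · subst hKJ
    have h1 : (Matrix.diagonal fun c => C δ * (if c ∈ Q then 1 + X else 1)).submatrix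
        (indexEmb K) (indexEmb K) = Matrix.diagonal fun b =>
          C δ * (if indexEmb K b ∈ Q then 1 + X else 1) :=
      Matrix.submatrix_diagonal _ _ (indexEmb K).injective
    rw [h1, Matrix.det_diagonal, Finset.prod_mul_distrib, Finset.prod_const, Finset.prod_ite,
      Finset.prod_const, Finset.prod_const_one, mul_one, ← C_pow, coeff_C_mul,
      coeff_one_add_X_pow, Finset.card_univ, Fintype.card_fin]
    have h2 : (Finset.univ.filter fun b => indexEmb K b ∈ Q) =
        Finset.univ.filter fun b => indexEmb K b ∈ K.1 ∩ Q := by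
      ext b
      simp [Finset.orderEmbOfFin_mem]
    rw [h2, card_filter_indexEmb K Finset.inter_subset_left]
  · obtain ⟨c, hc, hc'⟩ : ∃ c ∈ J.1, c ∉ K.1 := by
      by_contra! hcon
      exact hKJ (Subtype.ext (Finset.eq_of_subset_of_card_le hcon (by rw [J.2, K.2])).symm)
    have : c ∈ Set.range (indexEmb J) := by
      rw [Finset.range_orderEmbOfFin]; exact hc
    obtain ⟨b, hb⟩ := this
    rw [Matrix.det_eq_zero_of_column_eq_zero b, coeff_zero]
    intro i
    rw [Matrix.submatrix_apply, hb, Matrix.diagonal_apply_ne]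
    rintro rfl
    exact hc' (Finset.orderEmbOfFin_mem _ _ _)

/-- There are two variables here: the inner one, the curve parameter, is set to 0, and the outer
one, the shear parameter, is kept. -/
lemma map_shearMatrix_eval_zero (u : Fin (r + 1) → Fin (n + 1)) (δ : ℂ[X])
    {B : Matrix (Fin (r + 1)) (Fin (n + 1)) ℂ[X]} (Q : Finset (Fin (n + 1)))
    (hB : ∀ a c, (B a c).eval 0 = 0) :
    (shearMatrix u δ B Q).map (Polynomial.mapRingHom (evalRingHom (0 : ℂ))) =
      shearMatrix u (δ.eval 0) 0 Q := by
  refine Matrix.ext fun a c => ?_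
  rw [Matrix.map_apply, coe_mapRingHom, shearMatrix, Matrix.of_apply, Polynomial.map_sub,
    Polynomial.map_sum]
  simp [shearMatrix, apply_ite (Polynomial.map (evalRingHom (0 : ℂ))), hB]

/-- Degeneration of spans of osculating spaces, in adapted coordinates. -/
theorem eval_zero_mem_osc_coordMatrix {l k k' : ℕ} (hl : Subsingleton (Fin l) ∨ k' ≤ k)
    {u : Fin (r + 1) → Fin (n + 1)} (hu : Function.Injective u) {δ : ℂ[X]} (hδ : δ.eval 0 ≠ 0)
    {B : Fin l → Matrix (Fin (r + 1)) (Fin (n + 1)) ℂ[X]} {Q : Fin l → Finset (Fin (n + 1))}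
    (hQu : ∀ j i, u i ∉ Q j) (hQ : ∀ i j, i ≠ j → Disjoint (Q i) (Q j))
    (hB : ∀ j a, ∀ c ∉ Q j, B j a c = 0) (hB0 : ∀ j a c, (B j a c).eval 0 = 0)
    {w : PluckerIndex r n → ℂ[X]} {f : ℂ[X]} (hf : f ≠ 0)
    (hw : f • w ∈ osc k (coordMatrix ℂ[X] u) ⊔ ⨆ j, osc k' (δ • coordMatrix ℂ[X] u + B j)) :
    (fun J => (w J).eval 0) ∈ osc (k + k' + 1) (coordMatrix ℂ u) := by
  refine mem_osc_coordMatrix hu fun J hJ => ?_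
  set T := J.1 \ Finset.univ.image u with hT
  have hTJ : T ⊆ J.1 := Finset.sdiff_subset
  have hTu : ∀ c ∈ T, ∀ i, c ≠ u i := by
    rintro _ hc i rfl
    simp [hT] at hc
  -- a linear functional which vanishes on all generators vanishes at `w`
  have hkill : ∀ φ : (PluckerIndex r n → ℂ[X]) →ₗ[ℂ[X]] ℂ[X],
      (∀ (S : Finset (Fin (r + 1))) A', S.card ≤ k →
        φ (plucker (rowMix S A' (coordMatrix ℂ[X] u))) = 0) →
      (∀ (j : Fin l) (S : Finset (Fin (r + 1))) A', S.card ≤ k' →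
        φ (plucker (rowMix S A' (δ • coordMatrix ℂ[X] u + B j))) = 0) → φ w = 0 := by
    intro φ h1 h2
    have hle : osc k (coordMatrix ℂ[X] u) ⊔ ⨆ j, osc k' (δ • coordMatrix ℂ[X] u + B j) ≤
        LinearMap.ker φ := by
      refine sup_le ?_ (iSup_le fun j => ?_)
      · refine Submodule.span_le.mpr ?_
        rintro _ ⟨S, v, hS, rfl⟩
        exact h1 S _ hS
      · refine Submodule.span_le.mpr ?_
        rintro _ ⟨S, v, hS, rfl⟩
        exact h2 j S _ hS
    have := hle hw
    rw [LinearMap.mem_ker, map_smul, smul_eq_mul] at this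
    exact (mul_eq_zero.mp this).resolve_left hf
  -- If `T` lies in some `Q j` up to `k'` elements, then it meets `Q j` in at least k+2 elements and
  -- the shear for `j` applies. Otherwise the coordinate `J` itself already annihilates all
  -- generators.
  by_cases hbad : ∃ j, (T \ Q j).card ≤ k'
  · obtain ⟨j, hj⟩ := hbad
    let d : PluckerIndex r n → ℂ[X] := fun K =>
      ((shearMatrix u δ (B j) (Q j)).submatrix (indexEmb K) (indexEmb J)).det.coeff (k + 1)
    let φ : (PluckerIndex r n → ℂ[X]) →ₗ[ℂ[X]] ℂ[X] := Fintype.linearCombination ℂ[X] d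
    have hφ : ∀ z, φ z = ∑ K, z K * d K := fun z => by
      simp [φ, Fintype.linearCombination_apply]
    have hφp : ∀ A : Matrix (Fin (r + 1)) (Fin (n + 1)) ℂ[X], φ (plucker A) =
        ((A.map C * shearMatrix u δ (B j) (Q j)).submatrix id (indexEmb J)).det.coeff (k + 1) := by
      intro A
      rw [hφ]
      have h1 : (A.map C * shearMatrix u δ (B j) (Q j)).submatrix id (indexEmb J) =
        A.map C * (shearMatrix u δ (B j) (Q j)).submatrix id (indexEmb J) := rfl
      rw [h1, det_mul_eq_sum_plucker, finsetSum_coeff]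
      refine Finset.sum_congr rfl fun K _ => ?_
      rw [plucker_map, coeff_C_mul]
      rfl
    have hw0 : φ w = 0 := by
      refine hkill φ (fun S A' hS => ?_) fun i S A' hS => ?_
      · rw [hφp]
        refine coeff_det_shear_eq_zero hu δ (hQu j) (hB j) hJ _ _ (Or.inl ⟨hS, fun i c hc => ?_⟩)
        rw [coordMatrix_apply, if_neg]
        rintro rfl
        exact hQu j i hc
      · rw [hφp]
        by_cases hij : i = j
        · subst hij
          exact coeff_det_shear_eq_zero hu δ (hQu i) (hB i) hJ _ _ (Or.inr ⟨hS, rfl⟩)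
        · have hkk : k' ≤ k := hl.resolve_left fun h => hij (h.elim _ _)
          refine coeff_det_shear_eq_zero hu δ (hQu j) (hB j) hJ _ _
            (Or.inl ⟨hS.trans hkk, fun a c hc => ?_⟩)
          rw [Matrix.add_apply, Matrix.smul_apply, coordMatrix_apply, if_neg, smul_zero, zero_add]
          · exact hB i a c fun h => (Finset.disjoint_left.mp (hQ i j hij)) h hc
          · rintro rfl
            exact hQu j a hc
    have hd : ∀ K, (d K).eval 0 =
        if K = J then (δ.eval 0) ^ (r + 1) * ((J.1 ∩ Q j).card.choose (k + 1) : ℂ) else 0 := by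
      intro K
      rw [← coeff_det_shear_zero u, ← map_shearMatrix_eval_zero u δ (Q j) (hB0 j)]
      have h1 : ((shearMatrix u δ (B j) (Q j)).map
          (Polynomial.mapRingHom (evalRingHom (0 : ℂ)))).submatrix (indexEmb K) (indexEmb J) =
          (Polynomial.mapRingHom (evalRingHom (0 : ℂ))).mapMatrix
            ((shearMatrix u δ (B j) (Q j)).submatrix (indexEmb K) (indexEmb J)) := rfl
      rw [h1, ← RingHom.map_det, coe_mapRingHom, coeff_map]
      rfl
    have h0 := congrArg (Polynomial.eval 0) hw0
    rw [hφ, eval_finsetSum, eval_zero, Finset.sum_eq_single J] at h0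
    · rw [eval_mul, hd, if_pos rfl] at h0
      refine (mul_eq_zero.mp h0).resolve_right (mul_ne_zero (pow_ne_zero _ hδ) ?_)
      rw [Nat.cast_ne_zero]
      refine (Nat.choose_pos ?_).ne'
      have h1 : (T ∩ Q j).card ≤ (J.1 ∩ Q j).card :=
        Finset.card_le_card (Finset.inter_subset_inter_right hTJ)
      have h2 := Finset.card_sdiff_add_card_inter T (Q j)
      omega
    · intro K _ hK
      rw [eval_mul, hd, if_neg hK, mul_zero]
    · simp
  · push Not at hbad
    have hdet : ∀ (S : Finset (Fin (r + 1))) (A' A : Matrix (Fin (r + 1)) (Fin (n + 1)) ℂ[X])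
        (T' : Finset (Fin (n + 1))), T' ⊆ J.1 → S.card < T'.card →
        (∀ i, ∀ c ∈ T', A i c = 0) → plucker (rowMix S A' A) J = 0 := by
      intro S A' A T' hT' hS hA
      -- With the zero ideal the estimate says that a block of zeros which is too large makes the
      -- determinant vanish.
      have h1 := det_mem_pow (⊥ : Ideal ℂ[X]) ((rowMix S A' A).submatrix id (indexEmb J)) S
        (Finset.univ.filter fun b => indexEmb J b ∈ T') (by
          intro i hi b hb
          rw [Matrix.submatrix_apply, rowMix_apply, id, if_neg hi, Ideal.mem_bot]
          exact hA i _ (by simpa using hb))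
      rw [card_filter_indexEmb J hT'] at h1
      have h2 := Ideal.pow_le_self (I := (⊥ : Ideal ℂ[X])) (Nat.sub_pos_of_lt hS).ne' h1
      exact Ideal.mem_bot.mp h2
    have hE : ∀ i, ∀ c ∈ T, coordMatrix ℂ[X] u i c = 0 := fun i c hc => by
      rw [coordMatrix_apply, if_neg (hTu c hc i)]
    have hw0 : (LinearMap.proj J : (PluckerIndex r n → ℂ[X]) →ₗ[ℂ[X]] ℂ[X]) w = 0 := by
      refine hkill _ (fun S A' hS => ?_) fun j S A' hS => ?_
      · exact hdet S A' _ T hTJ (by omega) hE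
      · refine hdet S A' _ (T \ Q j) (Finset.sdiff_subset.trans hTJ)
          (lt_of_le_of_lt hS (hbad j)) fun i c hc => ?_
        rw [Finset.mem_sdiff] at hc
        rw [Matrix.add_apply, Matrix.smul_apply, hE i c hc.1, hB j i c hc.2, smul_zero, zero_add]
    have : w J = 0 := hw0
    rw [this, eval_zero]

lemma osc_mul_isUnit {R : Type*} [CommRing R] {m : ℕ} {A : Matrix (Fin (r + 1)) (Fin (n + 1)) R}
    {g g' : Matrix (Fin (n + 1)) (Fin (n + 1)) R} (hg : g * g' = 1) {w : PluckerIndex r n → R}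
    (hw : w ∈ osc m (A * g)) : compound r g' w ∈ osc m A := by
  have := osc_mul_compound_mem _ g' hw
  rwa [Matrix.mul_assoc, hg, Matrix.mul_one] at this

/-- Degeneration of spans of osculating spaces. -/
theorem eval_zero_mem_osc {l k k' : ℕ} (hl : Subsingleton (Fin l) ∨ k' ≤ k)
    {u : Fin (r + 1) → Fin (n + 1)} (hu : Function.Injective u) {δ : ℂ[X]} (hδ : δ.eval 0 ≠ 0)
    {B : Fin l → Matrix (Fin (r + 1)) (Fin (n + 1)) ℂ[X]} {Q : Fin l → Finset (Fin (n + 1))}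
    (hQu : ∀ j i, u i ∉ Q j) (hQ : ∀ i j, i ≠ j → Disjoint (Q i) (Q j))
    (hB : ∀ j a, ∀ c ∉ Q j, B j a c = 0) (hB0 : ∀ j a c, (B j a c).eval 0 = 0)
    {g g' : Matrix (Fin (n + 1)) (Fin (n + 1)) ℂ} (hg : g * g' = 1)
    {w : PluckerIndex r n → ℂ[X]} {f : ℂ[X]} (hf : f ≠ 0)
    (hw : f • w ∈ osc k (coordMatrix ℂ[X] u * g.map C) ⊔
      ⨆ j, osc k' ((δ • coordMatrix ℂ[X] u + B j) * g.map C)) :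
    (fun J => (w J).eval 0) ∈ osc (k + k' + 1) (coordMatrix ℂ u * g) := by
  have hgC : g.map (C : ℂ →+* ℂ[X]) * g'.map C = 1 := by
    rw [← Matrix.map_mul, hg]
    exact Matrix.map_one _ (map_zero _) (map_one _)
  have hle : osc k (coordMatrix ℂ[X] u * g.map C) ⊔
      ⨆ j, osc k' ((δ • coordMatrix ℂ[X] u + B j) * g.map C) ≤
      (osc k (coordMatrix ℂ[X] u) ⊔
        ⨆ j, osc k' (δ • coordMatrix ℂ[X] u + B j)).comap (compound r (g'.map C)) := by
    refine sup_le (fun z hz => ?_) (iSup_le fun j z hz => ?_)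
    · exact Submodule.mem_sup_left (osc_mul_isUnit hgC hz)
    · exact Submodule.mem_sup_right (Submodule.mem_iSup_of_mem j (osc_mul_isUnit hgC hz))
  have hw' := hle hw
  rw [Submodule.mem_comap, map_smul] at hw'
  have key := eval_zero_mem_osc_coordMatrix hl hu hδ hQu hQ hB hB0 hf hw'
  have h1 : (fun J => (compound r (g'.map (C : ℂ →+* ℂ[X])) w J).eval 0) =
      compound r g' fun J => (w J).eval 0 := by
    ext J
    rw [compound_apply, compound_apply, eval_finsetSum]
    refine Finset.sum_congr rfl fun K _ => ?_
    have h2 : (g'.map (C : ℂ →+* ℂ[X])).submatrix (indexEmb K) (indexEmb J) =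
        (C : ℂ →+* ℂ[X]).mapMatrix (g'.submatrix (indexEmb K) (indexEmb J)) := rfl
    rw [eval_mul, h2, ← RingHom.map_det, eval_C]
  rw [h1] at key
  have h3 := osc_mul_compound_mem _ g key
  rwa [compound_mul, mul_eq_one_comm.mp hg, compound_one] at h3

end Degeneration

/-! ### Families of osculating spaces, general position and pencils. -/

section OsculatingFamilies

open Polynomial

variable {r n : ℕ}

/-- Evaluation of vectors of polynomials at a closed point of the affine line. -/
def evalVector (ι : Type) (t : ClosedPoints ℂ[X]) : (ι → ℂ[X]) →ₛₗ[(t : ℂ[X] →+* ℂ)] (ι → ℂ) where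
  toFun w i := t (w i)
  map_add' w z := by ext; simp
  map_smul' a w := by ext; simp

instance ringHomSurjective_closedPoint (t : ClosedPoints ℂ[X]) :
    RingHomSurjective (t : ℂ[X] →+* ℂ) :=
  ⟨fun z => ⟨C z, by simp [closedPoint_apply t (C _)]⟩⟩

lemma evalVector_plucker (t : ClosedPoints ℂ[X])
    (A : Matrix (Fin (r + 1)) (Fin (n + 1)) ℂ[X]) :
    evalVector _ t (plucker A) = plucker (A.map t) := by
  ext J
  exact (plucker_map (t : ℂ[X] →+* ℂ) A J).symm

lemma map_evalVector_osc (t : ClosedPoints ℂ[X]) (m : ℕ)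
    (A : Matrix (Fin (r + 1)) (Fin (n + 1)) ℂ[X]) :
    (osc m A).map (evalVector _ t) = osc m (A.map t) := by
  rw [osc, Submodule.map_span, osc]
  congr 1
  have h : ∀ (S : Finset (Fin (r + 1))) (v : Fin (r + 1) → Fin (n + 1)),
      evalVector _ t (plucker (rowMix S (coordMatrix ℂ[X] v) A)) =
        plucker (rowMix S (coordMatrix ℂ v) (A.map t)) := by
    intro S v
    rw [evalVector_plucker]
    congr 1
    ext i j
    by_cases hi : i ∈ S <;> simp [rowMix_apply, hi, coordMatrix_apply, apply_ite t]
  ext z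
  constructor
  · rintro ⟨_, ⟨S, v, hS, rfl⟩, rfl⟩
    exact ⟨S, v, hS, h S v⟩
  · rintro ⟨S, v, hS, rfl⟩
    exact ⟨_, ⟨S, v, hS, rfl⟩, h S v⟩

lemma map_coordMatrix_mul (t : ClosedPoints ℂ[X]) (u : Fin (r + 1) → Fin (n + 1))
    (g : Matrix (Fin (n + 1)) (Fin (n + 1)) ℂ) :
    (coordMatrix ℂ[X] u * g.map C).map t = coordMatrix ℂ u * g := by
  ext i c
  simp [Matrix.mul_apply, coordMatrix_apply, closedPoint_apply t (C _)]

/-- The family is the fibrewise image of one submodule over ℂ[X], so the limit exists and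
`eval_zero_mem_osc` bounds it. The matrices need represent the curves only near 0, where `h` does
not vanish. -/
theorem exists_isFlatLimit_osculatingSpace {l k k' : ℕ} (hl : Subsingleton (Fin l) ∨ k' ≤ k)
    {u : Fin (r + 1) → Fin (n + 1)} (hu : Function.Injective u) {δ : ℂ[X]} (hδ : δ.eval 0 ≠ 0)
    {B : Fin l → Matrix (Fin (r + 1)) (Fin (n + 1)) ℂ[X]} {Q : Fin l → Finset (Fin (n + 1))}
    (hQu : ∀ j i, u i ∉ Q j) (hQ : ∀ i j, i ≠ j → Disjoint (Q i) (Q j))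
    (hB : ∀ j a, ∀ c ∉ Q j, B j a c = 0) (hB0 : ∀ j a c, (B j a c).eval 0 = 0)
    {g g' : Matrix (Fin (n + 1)) (Fin (n + 1)) ℂ} (hg : g * g' = 1)
    {p : ℙ ℂ (PluckerIndex r n → ℂ)} (hp : plucker (coordMatrix ℂ u * g) ∈ affineCone {p})
    {γ : Fin l → ClosedPoints ℂ[X] → ℙ ℂ (PluckerIndex r n → ℂ)} {h : ℂ[X]} (hh : h.eval 0 ≠ 0)
    (hγ : ∀ t : ClosedPoints ℂ[X], t h ≠ 0 → ∀ j,
      plucker (((δ • coordMatrix ℂ[X] u + B j) * g.map C).map t) ∈ affineCone {γ j t}) :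
    ∃ T₀, IsFlatLimit (affineLinePoint 0)
      (fun t => osculatingSpace (grassmannian r n) k p ⊔
        ⨆ j, osculatingSpace (grassmannian r n) k' (γ j t)) T₀ ∧
      T₀ ≤ osculatingSpace (grassmannian r n) (k + k' + 1) p := by
  refine exists_isFlatLimit (osc k (coordMatrix ℂ[X] u * g.map C) ⊔
    ⨆ j, osc k' ((δ • coordMatrix ℂ[X] u + B j) * g.map C)) hh _ (fun t ht => ?_) _ ?_
  · have h1 : ∀ P : Submodule ℂ[X] (PluckerIndex r n → ℂ[X]),
        Submodule.span ℂ ((fun (w : PluckerIndex r n → ℂ[X]) i => t (w i)) '' P) =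
          P.map (evalVector _ t) := fun P => by
      conv_rhs => rw [← Submodule.span_eq P, Submodule.map_span]
      rfl
    rw [h1, Submodule.map_sup, Submodule.map_iSup, map_evalVector_osc, map_coordMatrix_mul,
      osculatingSpace_grassmannian k hp]
    congr 1
    refine iSup_congr fun j => ?_
    rw [map_evalVector_osc, osculatingSpace_grassmannian k' (hγ t ht j)]
  · intro w f hf hw
    rw [osculatingSpace_grassmannian _ hp]
    exact eval_zero_mem_osc hl hu hδ hQu hQ hB hB0 hg hf hw

/-! ### Subspaces in general position -/

/-- Linearly independent subspaces are coordinate subspaces in a suitable basis. -/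
lemma exists_adapted_basis {m : ℕ} {A : Fin m → Matrix (Fin (r + 1)) (Fin (n + 1)) ℂ}
    (hA : LinearIndependent ℂ fun a : Fin m × Fin (r + 1) => A a.1 a.2) :
    ∃ (g g' : Matrix (Fin (n + 1)) (Fin (n + 1)) ℂ) (u : Fin m × Fin (r + 1) → Fin (n + 1)),
      g * g' = 1 ∧ Function.Injective u ∧
        ∀ j, A j = coordMatrix ℂ (fun i => u (j, i)) * g := by
  let b := Module.Basis.extend hA.linearIndepOn_id
  let e := b.indexEquiv (Pi.basisFun ℂ (Fin (n + 1)))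
  let u : Fin m × Fin (r + 1) → Fin (n + 1) := fun a =>
    e ⟨A a.1 a.2, Module.Basis.subset_extend hA.linearIndepOn_id ⟨a, rfl⟩⟩
  let g : Matrix (Fin (n + 1)) (Fin (n + 1)) ℂ := Matrix.of fun c => b (e.symm c)
  have hg : IsUnit g :=
    Matrix.linearIndependent_rows_iff_isUnit.mp (b.linearIndependent.comp _ e.symm.injective)
  obtain ⟨g', hg'⟩ := hg.exists_right_inv
  refine ⟨g, g', u, hg', ?_, ?_⟩
  · intro a a' haa
    have h1 := congrArg Subtype.val (e.injective haa)
    exact hA.injective h1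
  · intro j
    ext i c
    have h1 : (coordMatrix ℂ (fun i => u (j, i)) * g) i c = g (u (j, i)) c := by
      simp [Matrix.mul_apply, coordMatrix_apply]
    have h2 : b (e.symm (u (j, i))) = A j i := by
      simp only [u, Equiv.symm_apply_apply, b, Module.Basis.extend_apply_self]
    rw [h1]
    exact (congrFun h2 c).symm

lemma exists_mul_eq {m d : ℕ} {A : Fin m → Matrix (Fin (r + 1)) (Fin (n + 1)) ℂ}
    (hA : LinearIndependent ℂ fun a : Fin m × Fin (r + 1) => A a.1 a.2)
    (T : Fin m → Matrix (Fin (r + 1)) (Fin d) ℂ) :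
    ∃ N : Matrix (Fin (n + 1)) (Fin d) ℂ, ∀ j, A j * N = T j := by
  obtain ⟨g, g', u, hg, hu, hAu⟩ := exists_adapted_basis hA
  let N₀ : Matrix (Fin (n + 1)) (Fin d) ℂ :=
    Matrix.of (Function.extend u (fun a => T a.1 a.2) 0)
  refine ⟨g' * N₀, fun j => ?_⟩
  rw [hAu, Matrix.mul_assoc, ← Matrix.mul_assoc g, hg, Matrix.one_mul]
  ext i c
  have h1 : (coordMatrix ℂ (fun i => u (j, i)) * N₀) i c = N₀ (u (j, i)) c := by
    simp [Matrix.mul_apply, coordMatrix_apply]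
  rw [h1]
  exact congrFun (hu.extend_apply (fun a => T a.1 a.2) 0 (j, i)) c

/-- A linear map sending the rows of the two matrices to x and y times the standard basis turns the
pencil into a scalar matrix, invertible for suitable x and y. -/
lemma plucker_pencil_ne_zero {m : ℕ} {A : Fin m → Matrix (Fin (r + 1)) (Fin (n + 1)) ℂ}
    (hA : LinearIndependent ℂ fun a : Fin m × Fin (r + 1) => A a.1 a.2) {i j : Fin m}
    (hij : i ≠ j) {a b : ℂ} (hab : a ≠ 0 ∨ b ≠ 0) : plucker (a • A i + b • A j) ≠ 0 := by
  intro h0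
  obtain ⟨x, y, hxy⟩ : ∃ x y : ℂ, a * x + b * y ≠ 0 := by
    rcases hab with h | h
    · exact ⟨1, 0, by simpa using h⟩
    · exact ⟨0, 1, by simpa using h⟩
  obtain ⟨N, hN⟩ := exists_mul_eq hA (d := r + 1)
    fun s => if s = i then x • 1 else if s = j then y • 1 else 0
  have h1 : (a • A i + b • A j) * N = (a * x + b * y) • 1 := by
    rw [Matrix.add_mul, Matrix.smul_mul, Matrix.smul_mul, hN, hN, if_pos rfl, if_neg hij.symm,
      if_pos rfl, smul_smul, smul_smul, add_smul]
  have h2 := det_mul_eq_sum_plucker (a • A i + b • A j) N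
  rw [h1, h0, Matrix.det_smul, Matrix.det_one, mul_one] at h2
  simp only [Pi.zero_apply, zero_mul, Finset.sum_const_zero] at h2
  exact pow_ne_zero _ hxy h2

/-- General points of the Grassmannian are linearly independent subspaces. -/
theorem forGeneralPoints_grassmannian {m : ℕ} (hm : m * (r + 1) ≤ n + 1)
    {P : (Fin m → ℙ ℂ (PluckerIndex r n → ℂ)) → Prop}
    (hP : ∀ (p : Fin m → ℙ ℂ (PluckerIndex r n → ℂ))
      (A : Fin m → Matrix (Fin (r + 1)) (Fin (n + 1)) ℂ),
      (∀ j, plucker (A j) ∈ affineCone {p j}) →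
      LinearIndependent ℂ (fun a : Fin m × Fin (r + 1) => A a.1 a.2) → P p) :
    ForGeneralPoints (grassmannian r n) m P := by
  let e : Fin m × Fin (r + 1) → Fin (n + 1) := fun a => Fin.castLE hm (finProdFinEquiv a)
  have he : Function.Injective e := (Fin.castLE_injective hm).comp finProdFinEquiv.injective
  -- Disjoint blocks of columns, one for each point. The open set asks that each point lie in the
  -- chart of its block and that the stacked chart matrices be invertible on the union of the
  -- blocks; it contains the tuple of coordinate subspaces.
  let I : Fin m → PluckerIndex r n := fun j => ⟨Finset.univ.image fun i => e (j, i), by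
    rw [Finset.card_image_of_injective _ fun i i' h => (Prod.ext_iff.mp (he h)).2]; simp⟩
  let col : Fin m × Fin (r + 1) → Fin (n + 1) := fun a => indexEmb (I a.1) a.2
  have hcol : Function.Injective col := by
    rintro ⟨j, i⟩ ⟨j', i'⟩ h
    have h1 : col (j, i) ∈ (I j).1 := Finset.orderEmbOfFin_mem _ _ _
    have h2 : col (j', i') ∈ (I j').1 := Finset.orderEmbOfFin_mem _ _ _
    simp only [I, Finset.mem_image, Finset.mem_univ, true_and] at h1 h2
    obtain ⟨a, ha⟩ := h1
    obtain ⟨b, hb⟩ := h2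
    rw [← ha, ← hb] at h
    obtain rfl : j = j' := (Prod.ext_iff.mp (he h)).1
    have h3 : indexEmb (I j) i = indexEmb (I j) i' := by
      have : col (j, i) = col (j, i') := by rw [← ha, ← hb, h]
      exact this
    rw [(indexEmb (I j)).injective h3]
  let D : (Fin m → PluckerIndex r n → ℂ) → Matrix (Fin m × Fin (r + 1)) (Fin m × Fin (r + 1)) ℂ :=
    fun x => Matrix.of fun a b => chartMatrix (I a.1) (x a.1) a.2 (col b)
  let DX : Matrix (Fin m × Fin (r + 1)) (Fin m × Fin (r + 1))
      (MvPolynomial (Fin m × PluckerIndex r n) ℂ) :=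
    Matrix.of fun a b => chartMatrix (R := MvPolynomial (Fin m × PluckerIndex r n) ℂ) (I a.1)
      (fun K => MvPolynomial.X (a.1, K)) a.2 (col b)
  have hD : ∀ x : Fin m → PluckerIndex r n → ℂ,
      MvPolynomial.eval (fun a : Fin m × PluckerIndex r n => x a.1 a.2)
        (DX.det * ∏ j, MvPolynomial.X (j, I j)) = (D x).det * ∏ j, x j (I j) := by
    intro x
    simp only [map_mul, map_prod, MvPolynomial.eval_X, RingHom.map_det]
    congr 2
    ext a b
    have h1 := chartMatrix_map (R := MvPolynomial (Fin m × PluckerIndex r n) ℂ)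
      (MvPolynomial.eval fun a : Fin m × PluckerIndex r n => x a.1 a.2) (I a.1)
      (fun K => MvPolynomial.X (a.1, K))
    simp only [MvPolynomial.eval_X] at h1
    exact Matrix.ext_iff.mpr h1 a.2 (col b)
  refine ⟨DX.det * ∏ j, MvPolynomial.X (j, I j), ?_, ?_⟩
  · let E : Fin m → Matrix (Fin (r + 1)) (Fin (n + 1)) ℂ := fun j => coordMatrix ℂ (indexEmb (I j))
    have hEsub : ∀ j, (E j).submatrix id (indexEmb (I j)) = 1 := by
      intro j
      ext i i'
      simp only [E, Matrix.submatrix_apply, id, coordMatrix_apply, Matrix.one_apply]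
      exact if_congr ⟨fun h => ((indexEmb (I j)).injective h).symm, fun h => h ▸ rfl⟩ rfl rfl
    have hE1 : ∀ j, plucker (E j) (I j) = 1 := by
      intro j
      rw [plucker]
      erw [hEsub j]
      exact Matrix.det_one
    have hE0 : ∀ j, plucker (E j) ≠ 0 := by
      intro j h0
      have := hE1 j
      rw [h0] at this
      exact zero_ne_one this
    refine ⟨fun j => Projectivization.mk ℂ (plucker (E j)) (hE0 j), fun j => ?_,
      fun j => plucker (E j), fun j => ⟨hE0 j, rfl⟩, ?_⟩
    · exact mem_grassmannian_iff.mpr ⟨E j, hE0 j, rfl⟩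
    · refine (hD fun j => plucker (E j)).trans_ne ?_
      have h1 : D (fun j => plucker (E j)) = 1 := by
        ext a b
        simp only [D, Matrix.of_apply]
        rw [chartMatrix_plucker, hEsub, Matrix.adjugate_one, Matrix.one_mul, Matrix.one_apply]
        refine (coordMatrix_apply _ _ _).trans ?_
        exact if_congr ⟨fun h => (hcol h).symm, fun h => h ▸ rfl⟩ rfl rfl
      simp [h1, hE1]
  · rintro p ⟨hpX, x, hx, hne⟩
    rw [hD] at hne
    have hdet := left_ne_zero_of_mul hne
    have hprod := right_ne_zero_of_mul hne
    rw [Finset.prod_ne_zero_iff] at hprod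
    refine hP p (fun j => chartMatrix (I j) (x j)) (fun j => ?_) ?_
    · have hxX : x j ∈ affineCone (grassmannian r n) := by
        obtain ⟨h0, h1⟩ := hx j
        rw [Set.mem_singleton_iff] at h1
        exact ⟨h0, h1 ▸ hpX j⟩
      rw [plucker_chartMatrix _ hxX, mem_affineCone_singleton (hx j)]
      exact ⟨_, pow_ne_zero _ (hprod j (Finset.mem_univ j)), rfl⟩
    · have h1 : LinearIndependent ℂ (D x).row := Matrix.linearIndependent_rows_of_det_ne_zero hdet
      exact LinearIndependent.of_comp (LinearMap.funLeft ℂ ℂ col) h1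

/-- The affine line as a smooth curve. -/
def affineLine : SmoothAffineCurve where
  R := ℂ[X]
  smooth := {}
  dim_eq_one := IsPrincipalIdealRing.ringKrullDim_eq_one _ (Polynomial.not_isField ℂ)

/-- In an adapted basis the points are coordinate subspaces on disjoint index sets, and the curves
are the pencils (1-t)A₀ + tA_j on the affine line. -/
theorem exists_osculating_curves {l k k' : ℕ} (hl : Subsingleton (Fin l) ∨ k' ≤ k)
    {p : Fin (l + 1) → ℙ ℂ (PluckerIndex r n → ℂ)}
    {A : Fin (l + 1) → Matrix (Fin (r + 1)) (Fin (n + 1)) ℂ}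
    (hp : ∀ j, plucker (A j) ∈ affineCone {p j})
    (hA : LinearIndependent ℂ fun a : Fin (l + 1) × Fin (r + 1) => A a.1 a.2) :
    ∃ (C : SmoothAffineCurve) (t₀ tinf : ClosedPoints C.R)
      (γ : Fin l → ClosedPoints C.R → ℙ ℂ (PluckerIndex r n → ℂ)),
      (∀ j, IsMorphism (γ j) ∧ (∀ t, γ j t ∈ grassmannian r n) ∧ γ j t₀ = p 0 ∧
        γ j tinf = p j.succ) ∧
      ∃ T₀ : Submodule ℂ (PluckerIndex r n → ℂ),
        IsFlatLimit t₀ (fun t => osculatingSpace (grassmannian r n) k (p 0) ⊔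
          ⨆ j, osculatingSpace (grassmannian r n) k' (γ j t)) T₀ ∧
        T₀ ≤ osculatingSpace (grassmannian r n) (k + k' + 1) (p 0) := by
  obtain ⟨g, g', u, hg, hu, hAu⟩ := exists_adapted_basis hA
  let M : Fin l → Matrix (Fin (r + 1)) (Fin (n + 1)) ℂ[X] := fun j =>
    ((1 - X : ℂ[X]) • coordMatrix ℂ[X] (fun i => u (0, i)) +
      (X : ℂ[X]) • coordMatrix ℂ[X] fun i => u (j.succ, i)) * g.map C
  have hM : ∀ j (t : ClosedPoints ℂ[X]), (M j).map t = (1 - t X) • A 0 + t X • A j.succ := by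
    intro j t
    rw [hAu, hAu, ← Matrix.smul_mul, ← Matrix.smul_mul, ← Matrix.add_mul]
    ext i c
    simp [M, Matrix.mul_apply, coordMatrix_apply, apply_ite t, closedPoint_apply t (C _)]
  have hne : ∀ j (t : ClosedPoints ℂ[X]), plucker ((M j).map t) ≠ 0 := by
    intro j t
    rw [hM]
    refine plucker_pencil_ne_zero hA (Fin.succ_ne_zero j).symm ?_
    by_cases h : t X = 0
    · left; simp [h]
    · exact Or.inr h
  have hpt : ∀ {q q' : ℙ ℂ (PluckerIndex r n → ℂ)} {v}, v ∈ affineCone {q} → v ∈ affineCone {q'} →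
      q = q' := fun hq hq' => hq.2.symm.trans hq'.2
  let γ : Fin l → ClosedPoints ℂ[X] → ℙ ℂ (PluckerIndex r n → ℂ) := fun j t =>
    Projectivization.mk ℂ (plucker ((M j).map t)) (hne j t)
  have hγ : ∀ j t, plucker ((M j).map t) ∈ affineCone {γ j t} := fun j t => ⟨hne j t, rfl⟩
  refine ⟨affineLine, affineLinePoint 0, affineLinePoint 1, γ, fun j => ⟨?_, ?_, ?_, ?_⟩, ?_⟩
  · intro t
    have h1 : ∀ s : ClosedPoints ℂ[X], (fun K => s (plucker (M j) K)) = plucker ((M j).map s) :=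
      fun s => evalVector_plucker s (M j)
    refine ⟨plucker (M j), ?_, fun s hs => ?_⟩
    · exact (h1 t).trans_ne (hne j t)
    · simp only [γ]
      congr 1
      exact (h1 s).symm
  · exact fun t => mem_grassmannian_iff.mpr ⟨_, hγ j t⟩
  · refine hpt (hγ j _) ?_
    rw [hM]
    simpa [affineLinePoint] using hp 0
  · refine hpt (hγ j _) ?_
    rw [hM]
    simpa [affineLinePoint] using hp j.succ
  · have hu0 : ∀ j, Function.Injective fun i => u (j, i) := fun j i i' h =>
      (Prod.ext_iff.mp (hu h)).2
    refine exists_isFlatLimit_osculatingSpace (u := fun i => u (0, i)) (δ := 1 - X)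
      (B := fun j => (X : ℂ[X]) • coordMatrix ℂ[X] fun i => u (j.succ, i))
      (Q := fun j => Finset.univ.image fun i => u (j.succ, i)) (g := g) (g' := g') (h := 1)
      hl (hu0 0) (by simp) ?_ ?_ ?_ ?_ hg (hAu 0 ▸ hp 0) (by simp) fun t _ j => hγ j t
    · intro j i hi
      simp only [Finset.mem_image, Finset.mem_univ, true_and] at hi
      obtain ⟨a, ha⟩ := hi
      exact Fin.succ_ne_zero j (Prod.ext_iff.mp (hu ha)).1
    · intro i j hij
      rw [Finset.disjoint_left]
      intro c hc hc'
      simp only [Finset.mem_image, Finset.mem_univ, true_and] at hc hc'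
      obtain ⟨a, rfl⟩ := hc
      obtain ⟨b, hb⟩ := hc'
      exact hij (Fin.succ_injective _ (Prod.ext_iff.mp (hu hb)).1).symm
    · intro j a c hc
      rw [Matrix.smul_apply, coordMatrix_apply, if_neg, smul_zero]
      rintro rfl
      exact hc (Finset.mem_image_of_mem _ (Finset.mem_univ a))
    · intro j a c
      simp

end OsculatingFamilies

/-! ### Rational normal curves and arbitrary polynomial curves. -/

section RationalNormalCurves

open Polynomial

variable {r n : ℕ}

lemma eq_of_mem_affineCone {ι : Type} {p q : ℙ ℂ (ι → ℂ)} {v : ι → ℂ} (hp : v ∈ affineCone {p})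
    (hq : v ∈ affineCone {q}) : p = q :=
  hp.2.symm.trans hq.2

lemma plucker_rowMix_smul_smul {R : Type*} [CommRing R] (S : Finset (Fin (r + 1))) (a b : R)
    (B A : Matrix (Fin (r + 1)) (Fin (n + 1)) R) :
    plucker (rowMix S (b • B) (a • A)) =
      (a ^ (r + 1 - S.card) * b ^ S.card) • plucker (rowMix S B A) := by
  have h1 : rowMix S (b • B) (a • A) =
      Matrix.diagonal (fun i => if i ∈ S then b else a) * rowMix S B A := by
    ext i j
    by_cases hi : i ∈ S <;> simp [rowMix_apply, hi]
  rw [h1, plucker_mul_left, Matrix.det_diagonal, Finset.prod_ite, Finset.prod_const,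
    Finset.prod_const, mul_comm]
  congr 3
  · rw [Finset.filter_not, Finset.card_univ_sdiff]
    simp
  · simp

/-- The coefficients of the Plücker coordinates of a pencil of matrices. -/
def pencilCoeff (A B : Matrix (Fin (r + 1)) (Fin (n + 1)) ℂ) (i : Fin (r + 1 + 1)) :
    PluckerIndex r n → ℂ :=
  ∑ S : Finset (Fin (r + 1)) with S.card = (i : ℕ), plucker (rowMix S B A)

lemma sum_pencilCoeff (A B : Matrix (Fin (r + 1)) (Fin (n + 1)) ℂ) (a b : ℂ) :
    ∑ i : Fin (r + 1 + 1), (a ^ (r + 1 - i : ℕ) * b ^ (i : ℕ)) • pencilCoeff A B i =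
      plucker (a • A + b • B) := by
  rw [add_comm (a • A), plucker_add]
  simp only [plucker_rowMix_smul_smul, pencilCoeff, Finset.smul_sum]
  rw [← Finset.sum_fiberwise Finset.univ (fun S : Finset (Fin (r + 1)) =>
    (⟨S.card, Nat.lt_succ_of_le (by simpa using S.card_le_univ)⟩ : Fin (r + 1 + 1)))]
  refine Finset.sum_congr rfl fun i _ => ?_
  refine Finset.sum_congr ?_ fun S hS => ?_
  · ext S
    simp [Fin.ext_iff]
  · simp only [Finset.mem_filter, Finset.mem_univ, true_and, Fin.ext_iff] at hS
    rw [← hS]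

/-- For a set `K` of `k` rows, map the rows of `A 0` in `K` and those of `A 1` outside `K` to zero
and the others to the standard basis. The resulting determinant is 1 on the mixed wedge with `S = K`
and 0 on all others, hence dual to the k-th coefficient. -/
lemma linearIndependent_pencilCoeff {A : Fin 2 → Matrix (Fin (r + 1)) (Fin (n + 1)) ℂ}
    (hA : LinearIndependent ℂ fun a : Fin 2 × Fin (r + 1) => A a.1 a.2) :
    LinearIndependent ℂ (pencilCoeff (A 0) (A 1)) := by
  rw [Fintype.linearIndependent_iff]
  intro c hc k
  let K : Finset (Fin (r + 1)) := Finset.univ.filter fun i => (i : ℕ) < k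
  have hK : K.card = (k : ℕ) := by
    rw [Fin.card_filter_val_lt]
    have := k.2
    omega
  obtain ⟨N, hN⟩ := exists_mul_eq hA (d := r + 1)
    ![Matrix.diagonal fun i => if i ∈ K then 0 else 1,
      Matrix.diagonal fun i => if i ∈ K then 1 else 0]
  let L : (PluckerIndex r n → ℂ) →ₗ[ℂ] ℂ := Fintype.linearCombination ℂ
    fun J : PluckerIndex r n => (N.submatrix (indexEmb J) id).det
  have hL : ∀ M : Matrix (Fin (r + 1)) (Fin (n + 1)) ℂ, L (plucker M) = (M * N).det := by
    intro M
    rw [det_mul_eq_sum_plucker]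
    rfl
  have hLS : ∀ S : Finset (Fin (r + 1)), L (plucker (rowMix S (A 1) (A 0))) =
      if S = K then 1 else 0 := by
    intro S
    rw [hL, rowMix_mul, hN, hN]
    have h1 : rowMix S (![Matrix.diagonal fun i => if i ∈ K then (0 : ℂ) else 1,
        Matrix.diagonal fun i => if i ∈ K then (1 : ℂ) else 0] 1)
        (![Matrix.diagonal fun i => if i ∈ K then (0 : ℂ) else 1,
        Matrix.diagonal fun i => if i ∈ K then (1 : ℂ) else 0] 0) =
        Matrix.diagonal fun i => if i ∈ S ↔ i ∈ K then 1 else 0 := by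
      ext i j
      by_cases hi : i ∈ S <;> by_cases hk : i ∈ K <;> by_cases hij : i = j <;>
        simp [rowMix_apply, hi, hij] <;> simp_all
    rw [h1, Matrix.det_diagonal]
    split_ifs with hSK
    · simp [hSK]
    · obtain ⟨i, hi⟩ := not_forall.mp (mt Finset.ext_iff.mpr hSK)
      exact Finset.prod_eq_zero (Finset.mem_univ i) (if_neg hi)
  have hLc : ∀ i, L (pencilCoeff (A 0) (A 1) i) = if i = k then 1 else 0 := by
    intro i
    simp only [pencilCoeff, map_sum, hLS, Finset.sum_ite_eq', Finset.mem_filter, Finset.mem_univ,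
      true_and, hK]
    exact if_congr ⟨fun h => Fin.ext h.symm, fun h => h ▸ rfl⟩ rfl rfl
  have := congrArg L hc
  simpa [map_sum, hLc] using this

theorem exists_rationalNormalCurve {p : Fin 2 → ℙ ℂ (PluckerIndex r n → ℂ)}
    {A : Fin 2 → Matrix (Fin (r + 1)) (Fin (n + 1)) ℂ} (hp : ∀ j, plucker (A j) ∈ affineCone {p j})
    (hA : LinearIndependent ℂ fun a : Fin 2 × Fin (r + 1) => A a.1 a.2) :
    ∃ γ, IsRationalNormalCurve (r + 1) γ ∧ (∀ x, γ x ∈ grassmannian r n) ∧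
      γ (projLinePoint 0) = p 0 ∧ γ projLineInfty = p 1 := by
  have hne : ∀ v : Fin 2 → ℂ, v ≠ 0 → plucker (v 0 • A 0 + v 1 • A 1) ≠ 0 := by
    intro v hv
    refine plucker_pencil_ne_zero hA (by decide) ?_
    by_contra! h
    exact hv (funext (Fin.forall_fin_two.mpr h))
  let γ : ℙ ℂ (Fin 2 → ℂ) → ℙ ℂ (PluckerIndex r n → ℂ) := fun x =>
    Projectivization.mk ℂ (plucker (x.rep 0 • A 0 + x.rep 1 • A 1)) (hne _ x.rep_nonzero)
  have hγ : ∀ (v : Fin 2 → ℂ) (hv : v ≠ 0),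
      plucker (v 0 • A 0 + v 1 • A 1) ∈ affineCone {γ (Projectivization.mk ℂ v hv)} := by
    intro v hv
    obtain ⟨a, ha⟩ := (Projectivization.mk_eq_mk_iff' ℂ v _ hv
      (Projectivization.mk ℂ v hv).rep_nonzero).mp (Projectivization.mk_rep _).symm
    set w := (Projectivization.mk ℂ v hv).rep with hw
    have ha0 : a ≠ 0 := by
      rintro rfl
      exact hv (by rw [← ha, zero_smul])
    rw [mem_affineCone_singleton (v := plucker (w 0 • A 0 + w 1 • A 1)) ⟨hne w (by
      rw [hw]; exact Projectivization.rep_nonzero _), rfl⟩]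
    refine ⟨a ^ (r + 1), pow_ne_zero _ ha0, ?_⟩
    have h1 : v 0 • A 0 + v 1 • A 1 =
        (a • (1 : Matrix (Fin (r + 1)) (Fin (r + 1)) ℂ)) * (w 0 • A 0 + w 1 • A 1) := by
      rw [Matrix.smul_mul, Matrix.one_mul, smul_add, smul_smul, smul_smul, ← ha]
      rfl
    rw [h1, plucker_mul_left, Matrix.det_smul, Matrix.det_one, mul_one, Fintype.card_fin]
  refine ⟨γ, ⟨pencilCoeff (A 0) (A 1), linearIndependent_pencilCoeff hA, fun v hv => ?_⟩,
    fun x => mem_grassmannian_iff.mpr ⟨_, hne _ x.rep_nonzero, rfl⟩, ?_, ?_⟩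
  · rw [sum_pencilCoeff]
    exact hγ v hv
  · refine eq_of_mem_affineCone (hγ _ _) ?_
    simpa using hp 0
  · refine eq_of_mem_affineCone (hγ _ _) ?_
    simpa using hp 1

/-- Points of the Grassmannian have a representative which is the identity in some columns. -/
lemma exists_normalized_matrix {p : ℙ ℂ (PluckerIndex r n → ℂ)} (hp : p ∈ grassmannian r n) :
    ∃ (I : PluckerIndex r n) (A : Matrix (Fin (r + 1)) (Fin (n + 1)) ℂ),
      plucker A ∈ affineCone {p} ∧ A.submatrix id (indexEmb I) = 1 := by
  obtain ⟨A, hA⟩ := mem_grassmannian_iff.mp hp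
  obtain ⟨I, hI⟩ := Function.ne_iff.mp hA.1
  have hdet : IsUnit (A.submatrix id (indexEmb I)).det := isUnit_iff_ne_zero.mpr hI
  refine ⟨I, (A.submatrix id (indexEmb I))⁻¹ * A, ?_, ?_⟩
  · rw [plucker_mul_left, mem_affineCone_singleton hA]
    exact ⟨_, (Matrix.isUnit_nonsing_inv_det _ hdet).ne_zero, rfl⟩
  · exact Matrix.nonsing_inv_mul _ hdet

/-- Flat limits of spans of osculating spaces along an arbitrary polynomial curve. -/
theorem exists_isFlatLimit_of_polynomial_curve (k k' : ℕ) {p : ℙ ℂ (PluckerIndex r n → ℂ)}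
    {γ : ClosedPoints ℂ[X] → ℙ ℂ (PluckerIndex r n → ℂ)} (hX : ∀ t, γ t ∈ grassmannian r n)
    (hp : γ (affineLinePoint 0) = p) {w : PluckerIndex r n → ℂ[X]}
    (hw : ∀ t : ClosedPoints ℂ[X], evalVector _ t w ∈ affineCone {γ t}) :
    ∃ T₀, IsFlatLimit (affineLinePoint 0)
      (fun t => osculatingSpace (grassmannian r n) k p ⊔
        osculatingSpace (grassmannian r n) k' (γ t)) T₀ ∧
      T₀ ≤ osculatingSpace (grassmannian r n) (k + k' + 1) p := by
  have hpX : p ∈ grassmannian r n := hp ▸ hX _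
  obtain ⟨I, A, hA, hAI⟩ := exists_normalized_matrix hpX
  let u := indexEmb I
  let c : Matrix (Fin (r + 1)) (Fin (n + 1)) ℂ := coordMatrix ℂ u
  have hmulc : ∀ M : Matrix (Fin (r + 1)) (Fin (n + 1)) ℂ, M * c.transpose =
      M.submatrix id u := by
    intro M
    ext i j
    simp [Matrix.mul_apply, c, coordMatrix_apply]
  have hcc : c * c.transpose = 1 := by
    rw [hmulc]
    ext i j
    simp only [c, Matrix.submatrix_apply, id, coordMatrix_apply, Matrix.one_apply]
    exact if_congr ⟨fun h => (u.injective h).symm, fun h => h ▸ rfl⟩ rfl rfl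
  have hAc : (A - c) * c.transpose = 0 := by
    rw [Matrix.sub_mul, hcc, hmulc, hAI, sub_self]
  -- A unipotent change of basis moving the coordinate point `c` to `A`; its inverse `g'` leaves the
  -- columns of `I` of any matrix unchanged.
  let g := 1 + c.transpose * (A - c)
  let g' := 1 - c.transpose * (A - c)
  have hN : (c.transpose * (A - c)) * (c.transpose * (A - c)) = 0 := by
    rw [Matrix.mul_assoc, ← Matrix.mul_assoc (A - c), hAc, Matrix.zero_mul, Matrix.mul_zero]
  have hg : g * g' = 1 := by
    simp only [g, g']
    rw [Matrix.mul_sub, Matrix.mul_one, Matrix.add_mul, Matrix.one_mul, hN, add_zero,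
      add_sub_cancel_right]
  have hcg : c * g = A := by
    simp only [g, Matrix.mul_add, Matrix.mul_one, ← Matrix.mul_assoc, hcc, Matrix.one_mul]
    abel
  have hAg : A * g' = c := by
    rw [← hcg, Matrix.mul_assoc, hg, Matrix.mul_one]
  have hgu : ∀ M : Matrix (Fin (r + 1)) (Fin (n + 1)) ℂ,
      (M * g').submatrix id u = M.submatrix id u := by
    intro M
    rw [← hmulc, ← hmulc, Matrix.mul_assoc]
    simp only [g', Matrix.sub_mul, Matrix.one_mul, Matrix.mul_assoc, hAc, Matrix.mul_zero,
      sub_zero]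
  have hgC : g'.map (C : ℂ →+* ℂ[X]) * g.map C = 1 := by
    rw [← Matrix.map_mul, mul_eq_one_comm.mp hg]
    exact Matrix.map_one _ (map_zero _) (map_one _)
  let M : Matrix (Fin (r + 1)) (Fin (n + 1)) ℂ[X] := chartMatrix I w
  have hM : ∀ t : ClosedPoints ℂ[X], M.map t = chartMatrix I (evalVector _ t w) := fun t =>
    chartMatrix_map (t : ℂ[X] →+* ℂ) I w
  have hcone : ∀ t, evalVector _ t w ∈ affineCone (grassmannian r n) := fun t =>
    ⟨(hw t).1, by have := (hw t).2; rw [Set.mem_singleton_iff] at this; exact this ▸ hX t⟩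
  -- In the columns of `I` the chart matrix of the curve is `w I` times the identity, so the
  -- remainder `B` lives in the other columns; it vanishes at 0 because the curve starts at `A`.
  let B : Matrix (Fin (r + 1)) (Fin (n + 1)) ℂ[X] := M * g'.map C - w I • coordMatrix ℂ[X] u
  have hBt : ∀ t : ClosedPoints ℂ[X], B.map t =
      chartMatrix I (evalVector _ t w) * g' - (evalVector _ t w I) • c := by
    intro t
    rw [← hM]
    ext i j
    simp [B, c, Matrix.mul_apply, coordMatrix_apply, apply_ite t, closedPoint_apply t (C _),
      evalVector]
  have hrec : (w I • coordMatrix ℂ[X] u + B) * g.map C = M := by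
    simp only [B, add_sub_cancel, Matrix.mul_assoc, hgC, Matrix.mul_one]
  have hw0 := hw (affineLinePoint 0)
  rw [hp, mem_affineCone_singleton hA] at hw0
  obtain ⟨a, ha, hwa⟩ := hw0
  have hAI1 : plucker A I = 1 := by
    rw [plucker]
    exact (congrArg Matrix.det hAI).trans Matrix.det_one
  have hev : ∀ f : ℂ[X], f.eval 0 = affineLinePoint 0 f := fun f => by
    simp [affineLinePoint, Polynomial.coe_aeval_eq_eval]
  have hwI : (w I).eval 0 ≠ 0 := by
    have h1 := congrFun hwa I
    rw [Pi.smul_apply, hAI1, smul_eq_mul, mul_one] at h1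
    rw [hev]
    exact h1.trans_ne ha
  have hB0 : B.map (affineLinePoint 0) = 0 := by
    rw [hBt, hwa, chartMatrix_smul, chartMatrix_plucker, hAI, Matrix.adjugate_one, Matrix.one_mul,
      Matrix.smul_mul, hAg, Pi.smul_apply, hAI1, smul_eq_mul, mul_one, sub_self]
  have hBu : ∀ i j, B i (u j) = 0 := by
    intro i j
    refine Polynomial.funext fun z => ?_
    have h0 : (B.map (affineLinePoint z)).submatrix id u = 0 := by
      rw [hBt, Matrix.submatrix_sub]
      have h2 : ((evalVector _ (affineLinePoint z) w I) • c).submatrix id u =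
          (evalVector _ (affineLinePoint z) w I) • (c.submatrix id u) := rfl
      simp only [Pi.sub_apply]
      rw [h2, hgu, chartMatrix_submatrix I (hcone _), ← hmulc c, hcc, sub_self]
    have h1 : affineLinePoint z (B i (u j)) = 0 := Matrix.ext_iff.mpr h0 i j
    simpa [affineLinePoint, Polynomial.coe_aeval_eq_eval] using h1
  -- With one moving curve, `Q` may be the whole complement of `u`, and `k`, `k'` are unrelated.
  have main := exists_isFlatLimit_osculatingSpace (l := 1) (k := k) (k' := k')
    (Or.inl inferInstance) u.injective (δ := w I) hwI (B := fun _ => B)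
    (Q := fun _ => (Finset.univ.image u)ᶜ) (g := g) (g' := g') (p := p) (γ := fun _ => γ)
    (h := w I) (fun _ i => by simp)
    (fun i j hij => absurd (Subsingleton.elim i j) hij)
    (fun _ i j hj => by
      simp only [Finset.mem_compl, Finset.mem_image, Finset.mem_univ, true_and, not_not] at hj
      obtain ⟨b, rfl⟩ := hj
      exact hBu i b)
    (fun _ i j => by rw [hev]; exact Matrix.ext_iff.mpr hB0 i j)
    hg (by rw [show coordMatrix ℂ u * g = A from hcg]; exact hA) hwI
    (fun t ht _ => by
      rw [hrec, hM, plucker_chartMatrix I (hcone t), mem_affineCone_singleton (hw t)]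
      exact ⟨_, pow_ne_zero _ ht, rfl⟩)
  simpa only [ciSup_unique] using main

/-- Only the polynomial parametrization without common zeros is used; the degree and the endpoint at
infinity play no role. -/
theorem exists_isFlatLimit_of_rationalNormalCurve {e : ℕ}
    {γ : ℙ ℂ (Fin 2 → ℂ) → ℙ ℂ (PluckerIndex r n → ℂ)} (hγ : IsRationalNormalCurve e γ)
    (hX : ∀ x, γ x ∈ grassmannian r n) {p : ℙ ℂ (PluckerIndex r n → ℂ)}
    (hp : γ (projLinePoint 0) = p) (k k' : ℕ) :
    ∃ T₀, IsFlatLimit (affineLinePoint 0)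
      (fun t => osculatingSpace (grassmannian r n) k p ⊔
        osculatingSpace (grassmannian r n) k' (γ (projLinePoint (affineLineCoord t)))) T₀ ∧
      T₀ ≤ osculatingSpace (grassmannian r n) (k + k' + 1) p := by
  obtain ⟨a, -, ha⟩ := hγ
  refine exists_isFlatLimit_of_polynomial_curve k k'
    (γ := fun t => γ (projLinePoint (affineLineCoord t))) (fun t => hX _) ?_
    (w := fun K => ∑ i : Fin (e + 1), X ^ (i : ℕ) * C (a i K)) fun t => ?_
  · rw [← hp]
    simp [affineLineCoord, affineLinePoint]
  · have h1 := ha ![1, affineLineCoord t] (fun h => one_ne_zero (congrFun h 0))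
    have h2 : evalVector _ t (fun K => ∑ i : Fin (e + 1), X ^ (i : ℕ) * C (a i K)) =
        ∑ i : Fin (e + 1), (![1, affineLineCoord t] 0 ^ (e - i : ℕ) *
          ![1, affineLineCoord t] 1 ^ (i : ℕ)) • a i := by
      ext K
      simp [evalVector, affineLineCoord, closedPoint_apply t (C _)]
      exact Finset.sum_congr rfl fun _ _ => mul_comm _ _
    rw [h2]
    exact h1

end RationalNormalCurves

/-! ### The regularity statements. -/

theorem hasStrongTwoOsculatingRegularity_grassmannian {r n : ℕ} (hn : 2 * r + 1 ≤ n) :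
    HasStrongTwoOsculatingRegularity (grassmannian r n) := by
  refine forGeneralPoints_grassmannian (by omega) fun p A hp hA k₁ k₂ => ?_
  obtain ⟨C, t₀, tinf, γ, hγ, T₀, hT₀, hle⟩ :=
    exists_osculating_curves (k := k₁) (k' := k₂) (Or.inl inferInstance) hp hA
  obtain ⟨h1, h2, h3, h4⟩ := hγ 0
  refine ⟨C, t₀, tinf, γ 0, h1, h2, h3, h4, T₀, ?_, hle⟩
  simpa only [ciSup_unique, Fin.default_eq_zero] using hT₀

theorem hasOsculatingRegularity_grassmannian {r n m : ℕ} (hm : m * (r + 1) ≤ n + 1) :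
    HasOsculatingRegularity (grassmannian r n) m := by
  cases m with
  | zero => trivial
  | succ l =>
    refine forGeneralPoints_grassmannian hm fun p A hp hA k => ?_
    rw [two_mul]
    exact exists_osculating_curves (Or.inr le_rfl) hp hA

end

theorem mainTheorem10 (r n : ℕ) (hn : 2 * r + 1 ≤ n) :
    HasStrongTwoOsculatingRegularity (grassmannian r n) ∧
    (ForGeneralPoints (grassmannian r n) 2 fun p =>
      (∃ γ, IsRationalNormalCurve (r + 1) γ ∧ (∀ x, γ x ∈ grassmannian r n) ∧
        γ (projLinePoint 0) = p 0 ∧ γ projLineInfty = p 1) ∧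
      ∀ γ, IsRationalNormalCurve (r + 1) γ → (∀ x, γ x ∈ grassmannian r n) →
        γ (projLinePoint 0) = p 0 → γ projLineInfty = p 1 →
        ∀ k₁ k₂ : ℕ, ∃ T₀ : Submodule ℂ (PluckerIndex r n → ℂ),
          IsFlatLimit (affineLinePoint 0)
            (fun t => osculatingSpace (grassmannian r n) k₁ (p 0) ⊔
              osculatingSpace (grassmannian r n) k₂ (γ (projLinePoint (affineLineCoord t)))) T₀ ∧
          T₀ ≤ osculatingSpace (grassmannian r n) (k₁ + k₂ + 1) (p 0)) ∧
    HasOsculatingRegularity (grassmannian r n) ((n + 1) / (r + 1)) := by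
  refine ⟨hasStrongTwoOsculatingRegularity_grassmannian hn,
    forGeneralPoints_grassmannian (by omega) fun p A hp hA =>
      ⟨exists_rationalNormalCurve hp hA, fun γ hγ hX h0 _ k₁ k₂ =>
        exists_isFlatLimit_of_rationalNormalCurve hγ hX h0 k₁ k₂⟩,
    hasOsculatingRegularity_grassmannian (Nat.div_mul_le_self _ _)⟩
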